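/- **Setting.** Let $T>0$, let $(\Omega,\mathcal F,P)$ be a probability space carrying a standard $d$-dimensional Brownian motion $B=(B_t)_{0\le t\le T}$, and let $\mathbf F=(\mathcal F_t)_{0\le t\le T}$ be its natural filtration completed with the $P$-null sets of $\mathcal F$. Let $\mathcal M^2$ be the set of real progressively measurable processes $w$ with $E\int_0^T|w_s|^2ds<\infty$, and $\mathcal S^2$ the set of real progressively measurable continuous processes $w$ with $E[\sup_{t\le T}|w_t|^2]<\infty$. Let $X=(X_t)_{0\le t\le T}$ be an $\mathbf R^k$-valued progressively measurable continuous process, let $\mathcal I=\{1,\dots,m\}$ with $m\ge 2$, and let $\psi_i,g_{ij}:[0,T]\times\mathbf R^k\to\mathbf R$ ($i,j\in\mathcal I$) be continuous functions such that $(\psi_i(t,X_t))_t\in\mathcal M^2$ and $(g_{ij}(t,X_t))_t\in\mathcal S^2$. The switching costs $g_{ij}$ may be negative, but $g_{ii}=0$ and there is no free loop: for all $n\ge2$, all pairwise distinct modes $i_1,\dots,i_n\in\mathcal I$ and all $(t,x)\in[0,T]\times\mathbf R^k$, $$g_{i_1i_2}(t,x)+g_{i_2i_3}(t,x)+\dots+g_{i_{n-1}i_n}(t,x)+g_{i_ni_1}(t,x)>0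 .$$ **Strategies.** An admissible strategy is a sequence $(\tau_n,\xi_n)_{n\ge0}$ with $\tau_0=0$, $\xi_0=1$, where $\tau_0\le\tau_1\le\tau_2\le\cdots\le T$ are $\mathbf F$-stopping times, each $\xi_n$ is $\mathcal I$-valued and $\mathcal F_{\tau_n}$-measurable, and $P[\tau_n<T\ \ \forall n\ge0]=0$. Let $\mathcal D$ be the set of admissible strategies. The mode in force at time $t$ is $u_t=\mathbf 1_{[0,\tau_1]}(t)+\sum_{n\ge1}\xi_n\mathbf 1_{(\tau_n,\tau_{n+1}]}(t)$, and the expected total profit is $$J(\tau,\xi)=E\Big[\int_0^T\psi_{u_s}(s,X_s)\,ds-\sum_{n\ge1}g_{\xi_{n-1}\xi_n}(\tau_n,X_{\tau_n})\mathbf 1_{[\tau_n<T]}\Big],$$ where $E[Z]:=E[Z^+]-E[Z^-]\in[-\infty,\infty]$ as soon as one of the two terms is finite. **Theorem (Verification Theorem).** Assume that $Y^1,\dots,Y^m\in\mathcal S^2$ satisfy, for every $i\in\mathcal I$ and $t\le T$, almost surely $$Y^i_t=\operatorname*{ess\,sup}_{\tau}E\Big[\int_t^\tau\psi_i(s,X_s)\,ds+\max_{j\ne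 i}\big(-g_{ij}(\tau,X_\tau)+Y^j_\tau\big)\mathbf 1_{[\tau<T]}\,\Big|\,\mathcal F_t\Big],\qquad Y^i_T=0,$$ the essential supremum being over all $\mathbf F$-stopping times $\tau$ with $t\le\tau\le T$. Then: (i) for every strategy in $\mathcal D$ the positive part of the random variable inside $E$ in the definition of $J$ is integrable, so that $J$ is well defined on $\mathcal D$ with values in $[-\infty,\infty)$, and almost surely $$Y^1_0=\sup_{(\tau,\xi)\in\mathcal D}J(\tau,\xi).$$ (ii) Consider sequences $(\tau^*_n,\xi^*_n)_{n\ge0}$ with $\tau_0^*=0$, $\xi_0^*=1$ and, for $n\ge1$, $$\tau_n^*=\inf\Big\{s\ge\tau_{n-1}^*:\ Y_s^{\xi^*_{n-1}}=\max_{k\ne\xi^*_{n-1}}\big(-g_{\xi^*_{n-1}k}(s,X_s)+Y^k_s\big)\Big\}\wedge T,$$ where on $\{\tau_n^*<T\}$ the mode $\xi_n^*\ne\xi^*_{n-1}$ attains the maximum $\max_{k\ne\xi^*_{n-1}}\big(-g_{\xi^*_{n-1}k}(\tau^*_n,X_{\tau^*_n})+Y^k_{\tau^*_n}\big)$, ties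 being broken in such a way that $\xi^*_n$ is $\mathcal F_{\tau_n^*}$-measurable whenever $\tau_n^*$ is a stopping time. Such sequences exist, and for each of them the $\tau_n^*$ are $\mathbf F$-stopping times, the strategy $(\tau^*,\xi^*)$ is admissible and optimal, i.e. $J(\tau^*,\xi^*)\ge J(\tau,\xi)$ for all $(\tau,\xi)\in\mathcal D$, and its total switching cost is integrable; in particular $$-\infty<E\Big[\sum_{n\ge1}g_{\xi^*_{n-1}\xi^*_n}(\tau_n^*,X_{\tau_n^*})\mathbf 1_{[\tau_n^*<T]}\Big]<+\infty .$$ -/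

import Mathlib

open MeasureTheory ProbabilityTheory
open scoped ENNReal

namespace OptimalSwitching

noncomputable section

/-- The time interval `[0, T]`. With `Fact (0 ≤ T)` it is a complete linear order whose least
element `⊥` is the time `0` and whose greatest element `⊤` is the horizon `T`; the infimum of the
empty set is `T`. -/
abbrev Time (T : ℝ) : Type := Set.Icc (0 : ℝ) T

/-- Lebesgue measure on `[0, T]`. -/
def leb (T : ℝ) : Measure (Time T) := Measure.comap Subtype.val volume

/-- `B` is a standard `d`-dimensional Brownian motion on `[0, T]`: measurable, started at `0`,
almost surely continuous, and for `s ≤ t` the increment `B t - B s` has law `N(0, (t - s) I_d)` and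
is independent of `σ(B r, r ≤ s)`. -/
structure IsStdBrownianMotion {T : ℝ} [Fact (0 ≤ T)] {Ω : Type*} [MeasurableSpace Ω] {d : ℕ}
    (B : Time T → Ω → Fin d → ℝ) (P : Measure Ω) : Prop where
  measurable : ∀ t, Measurable (B t)
  start_zero : ∀ᵐ ω ∂P, B ⊥ ω = 0
  continuous_paths : ∀ᵐ ω ∂P, Continuous fun t => B t ω
  law_increment : ∀ s t : Time T, s ≤ t →
    P.map (fun ω => B t ω - B s ω) =
      Measure.pi fun _ : Fin d => gaussianReal 0 (Real.toNNReal ((t : ℝ) - (s : ℝ)))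
  indep_increment : ∀ s t : Time T, s ≤ t →
    Indep (MeasurableSpace.comap (fun ω => B t ω - B s ω) inferInstance)
      (⨆ r ≤ s, MeasurableSpace.comap (B r) inferInstance) P

/-- The natural filtration `σ(B s, s ≤ t)` of `B`, completed with the `P`-null sets. -/
def completedFiltration {T : ℝ} {Ω : Type*} [mΩ : MeasurableSpace Ω] {d : ℕ}
    (B : Time T → Ω → Fin d → ℝ) (hB : ∀ t, Measurable (B t)) (P : Measure Ω) :
    Filtration (Time T) mΩ where
  seq t := (⨆ r ≤ t, MeasurableSpace.comap (B r) inferInstance) ⊔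
    MeasurableSpace.generateFrom {A : Set Ω | MeasurableSet A ∧ P A = 0}
  mono' _ _ hst := sup_le_sup_right (biSup_mono fun _ hr => hr.trans hst) _
  le' _ := sup_le (iSup₂_le fun r _ => (hB r).comap_le)
    (MeasurableSpace.generateFrom_le fun _ hA => hA.1)

section Processes

variable {T : ℝ} {Ω : Type*} [mΩ : MeasurableSpace Ω]

/-- The class `ℳ²` of real progressively measurable processes with `E ∫₀ᵀ |w s|² ds < ∞`. -/
def MemM2 (F : Filtration (Time T) mΩ) (P : Measure Ω) (w : Time T → Ω → ℝ) : Prop :=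
  IsStronglyProgressive F w ∧ ∫⁻ ω, (∫⁻ s, ‖w s ω‖ₑ ^ 2 ∂leb T) ∂P < ∞

/-- The class `𝒮²` of real progressively measurable continuous processes with
`E sup_{t ≤ T} |w t|² < ∞`. -/
def MemS2 (F : Filtration (Time T) mΩ) (P : Measure Ω) (w : Time T → Ω → ℝ) : Prop :=
  IsStronglyProgressive F w ∧ (∀ ω, Continuous fun t => w t ω) ∧
    ∫⁻ ω, (⨆ t : Time T, ‖w t ω‖ₑ ^ 2) ∂P < ∞

/-- `τ : Ω → [0, T]` is a stopping time of the filtration `F`. -/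
def IsStopping (F : Filtration (Time T) mΩ) (τ : Ω → Time T) : Prop :=
  IsStoppingTime F fun ω => (τ ω : WithTop (Time T))

/-- `Z` is (a version of) the essential supremum of the family `S` of real random variables: the
least measurable function, up to null sets, that is almost surely above every member of `S`. -/
def IsEssSup (P : Measure Ω) (S : Set (Ω → ℝ)) (Z : Ω → ℝ) : Prop :=
  Measurable Z ∧ (∀ f ∈ S, f ≤ᵐ[P] Z) ∧
    ∀ Z' : Ω → ℝ, Measurable Z' → (∀ f ∈ S, f ≤ᵐ[P] Z') → Z ≤ᵐ[P] Z'

/-- The expectation `E[f⁺] - E[f⁻]` as an extended real number. It is the usual expectation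
whenever one of the two terms is finite. -/
def expectation (P : Measure Ω) (f : Ω → ℝ) : EReal :=
  ((∫⁻ ω, ENNReal.ofReal (f ω) ∂P : ℝ≥0∞) : EReal) -
    ((∫⁻ ω, ENNReal.ofReal (-f ω) ∂P : ℝ≥0∞) : EReal)

end Processes

section Snell

variable {T : ℝ} [Fact (0 ≤ T)] {Ω : Type*} [mΩ : MeasurableSpace Ω] {k m : ℕ}
  (ψ : Fin m → Time T → EuclideanSpace ℝ (Fin k) → ℝ)
  (g : Fin m → Fin m → Time T → EuclideanSpace ℝ (Fin k) → ℝ)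
  (X : Time T → Ω → EuclideanSpace ℝ (Fin k))
  (Y : Fin m → Time T → Ω → ℝ)

/-- The obstacle `max_{j ≠ i} (-g_{ij}(s, X s) + Y^j s)`. -/
def obstacle (i : Fin m) (s : Time T) (ω : Ω) : ℝ :=
  ⨆ j : {j : Fin m // j ≠ i}, (-g i j s (X s ω) + Y j s ω)

open Classical in
/-- `∫_t^τ ψ_i(s, X s) ds + max_{j ≠ i} (-g_{ij}(τ, X τ) + Y^j τ) 1_{τ < T}`. -/
def stoppingReward (i : Fin m) (t : Time T) (τ : Ω → Time T) (ω : Ω) : ℝ :=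
  (∫ s in Set.Ioc t (τ ω), ψ i s (X s ω) ∂leb T) +
    if τ ω < ⊤ then obstacle g X Y i (τ ω) ω else 0

/-- The coupled system of Snell envelopes, with terminal value `0`. -/
def IsSnellSystem (F : Filtration (Time T) mΩ) (P : Measure Ω) : Prop :=
  (∀ (i : Fin m) (t : Time T),
    IsEssSup P
      {f | ∃ τ : Ω → Time T, IsStopping F τ ∧ (∀ ω, t ≤ τ ω) ∧
        f = P[stoppingReward ψ g X Y i t τ | F t]}
      (Y i t)) ∧
  ∀ i : Fin m, Y i ⊤ =ᵐ[P] 0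

end Snell

/-- The data of a strategy: switching times `τ n` and modes `ξ n`, where `τ 0`, `ξ 0` stand for the
initial time and mode and `ξ n` is the mode chosen at `τ n`. -/
structure Strategy (T : ℝ) (Ω : Type*) (m : ℕ) where
  τ : ℕ → Ω → Time T
  ξ : ℕ → Ω → Fin m

section Strategies

variable {T : ℝ} [Fact (0 ≤ T)] {Ω : Type*} [mΩ : MeasurableSpace Ω] {k m : ℕ}

/-- The set `𝒟` of admissible strategies started in mode `i₀` at time `0`: nondecreasing stopping
times `τ n ≤ T`, modes `ξ n` that are `F_{τ n}`-measurable, and almost surely only finitely many of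
the `τ n` are `< T`. -/
structure IsAdmissible (F : Filtration (Time T) mΩ) (P : Measure Ω) (i₀ : Fin m)
    (S : Strategy T Ω m) : Prop where
  τ_zero : ∀ ω, S.τ 0 ω = ⊥
  ξ_zero : ∀ ω, S.ξ 0 ω = i₀
  mono : ∀ n ω, S.τ n ω ≤ S.τ (n + 1) ω
  stopping : ∀ n, IsStopping F (S.τ n)
  measurable_mode : ∀ n (h : IsStopping F (S.τ n)),
    Measurable[IsStoppingTime.measurableSpace h] (S.ξ n)
  finite_switching : P {ω | ∀ n, S.τ n ω < ⊤} = 0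

open Classical in
/-- The mode `u t = ξ 0 · 1_{[0, τ 1]}(t) + ∑_{n ≥ 1} ξ n · 1_{(τ n, τ (n+1)]}(t)` in force at
time `t`. -/
def Strategy.mode (S : Strategy T Ω m) (t : Time T) (ω : Ω) : Fin m :=
  if h : ∃ n, S.τ n ω < t ∧ t ≤ S.τ (n + 1) ω then S.ξ (Nat.find h) ω else S.ξ 0 ω

variable (ψ : Fin m → Time T → EuclideanSpace ℝ (Fin k) → ℝ)
  (g : Fin m → Fin m → Time T → EuclideanSpace ℝ (Fin k) → ℝ)
  (X : Time T → Ω → EuclideanSpace ℝ (Fin k))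
  (Y : Fin m → Time T → Ω → ℝ)

open Classical in
/-- The total switching cost `∑_{n ≥ 1} g_{ξ (n-1) ξ n}(τ n, X (τ n)) 1_{τ n < T}`. -/
def Strategy.totalCost (S : Strategy T Ω m) (ω : Ω) : ℝ :=
  ∑' n : ℕ, if S.τ (n + 1) ω < ⊤ then
    g (S.ξ n ω) (S.ξ (n + 1) ω) (S.τ (n + 1) ω) (X (S.τ (n + 1) ω) ω) else 0

/-- The total profit `∫_0^T ψ_{u s}(s, X s) ds` minus the total switching cost. -/
def Strategy.profit (S : Strategy T Ω m) (ω : Ω) : ℝ :=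
  (∫ s, ψ (S.mode s ω) s (X s ω) ∂leb T) - S.totalCost g X ω

/-- The expected total profit `J` of a strategy. -/
def J (P : Measure Ω) (S : Strategy T Ω m) : EReal :=
  expectation P (S.profit ψ g X)

/-- `S` is a strategy of successive first hitting times: `τ (n+1)` is the first time after `τ n` at
which `Y^{ξ n}` meets its obstacle (or `T` if there is none), and on `{τ (n+1) < T}` the mode
`ξ (n+1)` realizes the maximum in the obstacle. Ties are broken in any way such that each mode is
known at the time at which it is chosen. -/
structure IsFirstHitting (F : Filtration (Time T) mΩ) (i₀ : Fin m)
    (S : Strategy T Ω m) : Prop where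
  τ_zero : ∀ ω, S.τ 0 ω = ⊥
  ξ_zero : ∀ ω, S.ξ 0 ω = i₀
  τ_succ : ∀ n ω, S.τ (n + 1) ω =
    sInf {s : Time T | S.τ n ω ≤ s ∧ Y (S.ξ n ω) s ω = obstacle g X Y (S.ξ n ω) s ω}
  ξ_succ : ∀ n ω, S.τ (n + 1) ω < ⊤ → S.ξ (n + 1) ω ≠ S.ξ n ω ∧
    obstacle g X Y (S.ξ n ω) (S.τ (n + 1) ω) ω =
      -g (S.ξ n ω) (S.ξ (n + 1) ω) (S.τ (n + 1) ω) (X (S.τ (n + 1) ω) ω) +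
        Y (S.ξ (n + 1) ω) (S.τ (n + 1) ω) ω
  measurable_mode : ∀ n (h : IsStopping F (S.τ n)),
    Measurable[IsStoppingTime.measurableSpace h] (S.ξ n)

end Strategies

end

end OptimalSwitching

/-! Write `I^i` for the running profit in mode `i`. The process `Y^i + I^i` is a Snell envelope: a
continuous supermartingale dominated by a square integrable variable
(`IsSnellEnvelope.supermartingale_le`), and a martingale from any stopping time to the next contact
of `Y^i` with its obstacle (`IsSnellEnvelope.stopped_eq`). Along a strategy, adding and subtracting
`Y` at each switch (`Strategy.partialProfit_eq`) turns the profit up to `τ n` into the initial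
value, minus `Y^{ξ n}` at `τ n`, plus gains, minus losses. A gain is an increment of `Y^i + I^i`
over a period spent in mode `i`; a loss is the amount by which a switch falls short of `Y`, and is
nonnegative because `Y` lies above its obstacle. Once `τ n = T` the boundary term is zero.

It remains to see that the gains have nonpositive mean. The number of switches is finite but
unbounded, and the costs have no sign, so the partial sums are not obviously dominated and
expectations cannot simply be passed to the limit. For a fixed mode, however, the gains are the
increments of a discrete supermartingale, `Y^i + I^i` sampled at the `τ n`, selected by the events
`ξ n = i`. Adding the compensator increments makes the selected sum a martingale whose second moment
is bounded uniformly in `n` and in the selection (`integral_sq_selectedMartingale_le`). It therefore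
converges almost surely and in mean, to a limit of mean zero. Summing over the finitely many modes
bounds the profit by the initial value plus a centred integrable variable
(`IsAdmissible.exists_profit_le`).

For first hitting strategies both inequalities are equalities: no drift between contacts, no loss at
a switch. They are admissible because infinitely many switches would accumulate at some time; by
continuity the switching relations hold there exactly, and a loop of modes would have total cost
zero (`IsFirstHitting.exists_eq_top`). Finally `F ⊥` is trivial, so the initial value equals its
mean almost surely. -/

namespace OptimalSwitching

/-! ### Discrete time: selected increments of an `L²`-dominated supermartingale. -/

section DiscreteTime

open Filter Topology

variable {Ω : Type*} {mΩ : MeasurableSpace Ω} {P : Measure Ω}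

set_option linter.unusedSectionVars false

variable [IsProbabilityMeasure P]

theorem integral_mul_condExp {m : MeasurableSpace Ω} (hm : m ≤ mΩ) {f h : Ω → ℝ}
    (hf : StronglyMeasurable[m] f) (hf2 : MemLp f 2 P) (hh2 : MemLp h 2 P) :
    ∫ ω, f ω * (P[h | m]) ω ∂P = ∫ ω, f ω * h ω ∂P := by
  have hfh : Integrable (f * h) P := hf2.integrable_mul hh2
  have h1 := condExp_mul_of_stronglyMeasurable_left hf hfh (hh2.integrable (by norm_num))
  calc ∫ ω, f ω * (P[h | m]) ω ∂P = ∫ ω, (P[f * h | m]) ω ∂P :=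
        integral_congr_ae (h1.mono fun ω hω => hω.symm)
    _ = ∫ ω, f ω * h ω ∂P := by rw [integral_condExp hm]; rfl

/-- Where `|f| ≥ c` one has `|f| ≤ f² / c`, so the tails are at most `C / c`. -/
theorem uniformIntegrable_of_integral_sq_le {f : ℕ → Ω → ℝ} {C : ℝ} (hf : ∀ n, MemLp (f n) 2 P)
    (hC : ∀ n, ∫ ω, f n ω ^ 2 ∂P ≤ C) : UniformIntegrable f 1 P := by
  refine uniformIntegrable_of le_rfl ENNReal.one_ne_top (fun n => (hf n).1) fun ε hε => ?_
  have hC0 : 0 ≤ C := (integral_nonneg fun ω => sq_nonneg (f 0 ω)).trans (hC 0)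
  -- Then `C ≤ ε * c`; the summand `1` keeps `c` positive when `C = 0`.
  set c : ℝ := C / ε + 1 with hc
  have hc0 : 0 < c := by positivity
  refine ⟨⟨c, hc0.le⟩, fun n => ?_⟩
  rw [eLpNorm_one_eq_lintegral_enorm]
  calc ∫⁻ ω, ‖{x | (⟨c, hc0.le⟩ : NNReal) ≤ ‖f n x‖₊}.indicator (f n) ω‖ₑ ∂P
      ≤ ∫⁻ ω, ENNReal.ofReal (f n ω ^ 2 / c) ∂P := by
        refine lintegral_mono fun ω => ?_
        by_cases hω : ω ∈ {x | (⟨c, hc0.le⟩ : NNReal) ≤ ‖f n x‖₊}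
        · rw [Set.indicator_of_mem hω, Real.enorm_eq_ofReal_abs]
          refine ENNReal.ofReal_le_ofReal ?_
          have h1 : c ≤ |f n ω| := hω
          rw [le_div_iff₀ hc0, ← sq_abs]
          nlinarith [abs_nonneg (f n ω)]
        · rw [Set.indicator_of_notMem hω]
          simp
    _ = ENNReal.ofReal (∫ ω, f n ω ^ 2 / c ∂P) := by
        rw [ofReal_integral_eq_lintegral_ofReal ((hf n).integrable_sq.div_const c)]
        exact ae_of_all _ fun ω => by positivity
    _ ≤ ENNReal.ofReal ε := by
        refine ENNReal.ofReal_le_ofReal ?_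
        rw [integral_div, div_le_iff₀ hc0, hc]
        have : ε * (C / ε + 1) = C + ε := by field_simp
        linarith [hC n]

variable {𝒢 : Filtration ℕ mΩ} {Z : ℕ → Ω → ℝ} {W : Ω → ℝ}

/-- The increments of the compensator of `Z`. -/
noncomputable def compensatorIncrement (P : Measure Ω) (𝒢 : Filtration ℕ mΩ) (Z : ℕ → Ω → ℝ)
    (l : ℕ) : Ω → ℝ := P[Z l - Z (l + 1) | 𝒢 l]

theorem memLp_two_of_abs_le (hZm : ∀ n, StronglyMeasurable[𝒢 n] (Z n)) (hW : MemLp W 2 P)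
    (hZW : ∀ n ω, |Z n ω| ≤ W ω) (n : ℕ) : MemLp (Z n) 2 P :=
  hW.mono ((hZm n).mono (𝒢.le n)).aestronglyMeasurable
    (ae_of_all _ fun ω => (hZW n ω).trans (le_abs_self _))

theorem stronglyMeasurable_compensatorIncrement {l n : ℕ} (h : l ≤ n) :
    StronglyMeasurable[𝒢 n] (compensatorIncrement P 𝒢 Z l) :=
  stronglyMeasurable_condExp.mono (𝒢.mono h)

theorem memLp_compensatorIncrement (hZ2 : ∀ n, MemLp (Z n) 2 P) (l : ℕ) :
    MemLp (compensatorIncrement P 𝒢 Z l) 2 P :=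
  ((hZ2 l).sub (hZ2 (l + 1))).condExp one_le_two

theorem integral_mul_compensatorIncrement (hZ2 : ∀ n, MemLp (Z n) 2 P) {n : ℕ} {f : Ω → ℝ}
    (hf : StronglyMeasurable[𝒢 n] f) (hf2 : MemLp f 2 P) :
    ∫ ω, f ω * compensatorIncrement P 𝒢 Z n ω ∂P = ∫ ω, f ω * (Z n ω - Z (n + 1) ω) ∂P :=
  integral_mul_condExp (𝒢.le n) hf hf2 ((hZ2 n).sub (hZ2 (n + 1)))

theorem integral_mul_sum_compensatorIncrement (hZ2 : ∀ n, MemLp (Z n) 2 P) {l n : ℕ}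
    (hln : l ≤ n) {f : Ω → ℝ} (hf : StronglyMeasurable[𝒢 l] f) (hf2 : MemLp f 2 P) :
    ∫ ω, f ω * ∑ j ∈ Finset.Ico l n, compensatorIncrement P 𝒢 Z j ω ∂P =
      ∫ ω, f ω * (Z l ω - Z n ω) ∂P := by
  induction n, hln using Nat.le_induction with
  | base => simp
  | succ n hln ih =>
    have h1 : Integrable (fun ω => f ω * ∑ j ∈ Finset.Ico l n, compensatorIncrement P 𝒢 Z j ω) P :=
      hf2.integrable_mul (memLp_finsetSum _ fun j _ => memLp_compensatorIncrement hZ2 j)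
    have h2 : Integrable (fun ω => f ω * compensatorIncrement P 𝒢 Z n ω) P :=
      hf2.integrable_mul (memLp_compensatorIncrement hZ2 n)
    have h3 : Integrable (fun ω => f ω * (Z l ω - Z n ω)) P :=
      hf2.integrable_mul ((hZ2 l).sub (hZ2 n))
    have h4 : Integrable (fun ω => f ω * (Z n ω - Z (n + 1) ω)) P :=
      hf2.integrable_mul ((hZ2 n).sub (hZ2 (n + 1)))
    simp only [Finset.sum_Ico_succ_top hln, mul_add]
    rw [integral_add h1 h2, ih,
      integral_mul_compensatorIncrement hZ2 (hf.mono (𝒢.mono hln)) hf2, ← integral_add h3 h4]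
    exact integral_congr_ae (ae_of_all _ fun ω => by simp only; ring)

/-- The two sides differ by the sum of the `p l ^ 2`, since the diagonal is counted twice on the
right. -/
theorem sq_sum_range_le (p : ℕ → ℝ) (n : ℕ) :
    (∑ l ∈ Finset.range n, p l) ^ 2 ≤
      2 * ∑ l ∈ Finset.range n, p l * ∑ j ∈ Finset.Ico l n, p j := by
  induction n with
  | zero => simp
  | succ n ih =>
    have h : ∀ l ∈ Finset.range n, p l * ∑ j ∈ Finset.Ico l (n + 1), p j =
        p l * ∑ j ∈ Finset.Ico l n, p j + p l * p n := fun l hl => by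
      rw [Finset.sum_Ico_succ_top (Finset.mem_range.1 hl).le, mul_add]
    rw [Finset.sum_range_succ, Finset.sum_range_succ, Finset.sum_congr rfl h,
      Finset.sum_add_distrib, ← Finset.sum_mul]
    simp only [Nat.Ico_succ_singleton, Finset.sum_singleton]
    nlinarith [sq_nonneg (p n)]

theorem compensatorIncrement_nonneg (hZ : Supermartingale Z 𝒢 P) (l : ℕ) :
    0 ≤ᵐ[P] compensatorIncrement P 𝒢 Z l := by
  have h1 := hZ.2.1 l (l + 1) l.le_succ
  have h2 := condExp_sub (hZ.integrable l) (hZ.integrable (l + 1)) (𝒢 l)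
  have h3 := condExp_of_stronglyMeasurable (𝒢.le l) (hZ.1 l) (hZ.integrable l)
  filter_upwards [h1, h2] with ω h1 h2
  rw [compensatorIncrement, h2]
  simp only [Pi.sub_apply, Pi.zero_apply, h3]
  linarith

/-- Pairing `p l` with the part of the compensator from `l` on amounts to pairing it with `Z l - Z n
≤ 2 W`. Hence the compensator `K` satisfies `E K² ≤ 4 E[W K]`, and `4 W K ≤ 8 W² + K² / 2` absorbs
`K`. Since `p l ≥ 0`, the pointwise bound suffices and `W` need not be adapted. -/
theorem integral_sq_compensator_le (hZ : Supermartingale Z 𝒢 P) (hW : MemLp W 2 P)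
    (hZW : ∀ n ω, |Z n ω| ≤ W ω) (n : ℕ) :
    ∫ ω, (∑ l ∈ Finset.range n, compensatorIncrement P 𝒢 Z l ω) ^ 2 ∂P ≤
      16 * ∫ ω, W ω ^ 2 ∂P := by
  set p := compensatorIncrement P 𝒢 Z with hp
  have hZ2 := memLp_two_of_abs_le hZ.1 hW hZW
  have hp2 := memLp_compensatorIncrement (𝒢 := 𝒢) hZ2
  have hK2 : MemLp (fun ω => ∑ l ∈ Finset.range n, p l ω) 2 P :=
    memLp_finsetSum _ fun j _ => hp2 j
  have hint : ∀ l, Integrable (fun ω => p l ω * ∑ j ∈ Finset.Ico l n, p j ω) P := fun l =>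
    (hp2 l).integrable_mul (memLp_finsetSum _ fun j _ => hp2 j)
  have hWp : ∀ l, Integrable (fun ω => W ω * p l ω) P := fun l => hW.integrable_mul (hp2 l)
  have hWK : Integrable (fun ω => W ω * ∑ l ∈ Finset.range n, p l ω) P := hW.integrable_mul hK2
  have h1 : ∫ ω, (∑ l ∈ Finset.range n, p l ω) ^ 2 ∂P ≤
      4 * ∫ ω, W ω * ∑ l ∈ Finset.range n, p l ω ∂P := by
    calc ∫ ω, (∑ l ∈ Finset.range n, p l ω) ^ 2 ∂P
        ≤ ∫ ω, 2 * ∑ l ∈ Finset.range n, p l ω * ∑ j ∈ Finset.Ico l n, p j ω ∂P :=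
          integral_mono hK2.integrable_sq
            ((integrable_finsetSum _ fun l _ => hint l).const_mul 2)
            fun ω => sq_sum_range_le (fun l => p l ω) n
      _ = 2 * ∑ l ∈ Finset.range n, ∫ ω, p l ω * ∑ j ∈ Finset.Ico l n, p j ω ∂P := by
          rw [integral_const_mul, integral_finsetSum _ fun l _ => hint l]
      _ ≤ 2 * ∑ l ∈ Finset.range n, ∫ ω, 2 * (W ω * p l ω) ∂P := by
          refine mul_le_mul_of_nonneg_left (Finset.sum_le_sum fun l hl => ?_) zero_le_two
          rw [integral_mul_sum_compensatorIncrement hZ2 (Finset.mem_range.1 hl).le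
            (stronglyMeasurable_compensatorIncrement le_rfl) (hp2 l)]
          refine integral_mono_ae ((hp2 l).integrable_mul ((hZ2 l).sub (hZ2 n)))
            ((hWp l).const_mul 2) ?_
          filter_upwards [compensatorIncrement_nonneg hZ l] with ω hω
          have h2 := abs_le.1 (hZW l ω)
          have h3 := abs_le.1 (hZW n ω)
          have h4 : Z l ω - Z n ω ≤ 2 * W ω := by linarith
          have h5 : 0 ≤ p l ω := hω
          nlinarith [mul_le_mul_of_nonneg_left h4 h5]
      _ = 4 * ∫ ω, W ω * ∑ l ∈ Finset.range n, p l ω ∂P := by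
          simp only [integral_const_mul, Finset.mul_sum]
          rw [integral_finsetSum _ fun l _ => hWp l, Finset.mul_sum]
          exact Finset.sum_congr rfl fun l _ => by ring
  have h2 : 4 * ∫ ω, W ω * ∑ l ∈ Finset.range n, p l ω ∂P ≤
      8 * ∫ ω, W ω ^ 2 ∂P + (∫ ω, (∑ l ∈ Finset.range n, p l ω) ^ 2 ∂P) / 2 := by
    rw [← integral_const_mul, ← integral_const_mul, ← integral_div,
      ← integral_add (hW.integrable_sq.const_mul 8) (hK2.integrable_sq.div_const 2)]
    refine integral_mono (hWK.const_mul 4)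
      ((hW.integrable_sq.const_mul 8).add (hK2.integrable_sq.div_const 2)) fun ω => ?_
    simp only
    nlinarith [sq_nonneg (4 * W ω - ∑ l ∈ Finset.range n, p l ω)]
  linarith

/-- The martingale obtained by summing the compensated increments of `Z` over the times `l` with
`A l`. -/
noncomputable def selectedMartingale (P : Measure Ω) (𝒢 : Filtration ℕ mΩ) (Z : ℕ → Ω → ℝ)
    (A : ℕ → Set Ω) (n : ℕ) (ω : Ω) : ℝ :=
  ∑ l ∈ Finset.range n,
    (A l).indicator (fun ω => Z (l + 1) ω - Z l ω + compensatorIncrement P 𝒢 Z l ω) ω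

variable {A : ℕ → Set Ω}

theorem memLp_selectedMartingale (hZ2 : ∀ n, MemLp (Z n) 2 P)
    (hA : ∀ n, MeasurableSet[𝒢 n] (A n)) (n : ℕ) :
    MemLp (selectedMartingale P 𝒢 Z A n) 2 P :=
  memLp_finsetSum _ fun l _ => (((hZ2 (l + 1)).sub (hZ2 l)).add
    (memLp_compensatorIncrement hZ2 l)).indicator (𝒢.le l _ (hA l))

theorem stronglyMeasurable_selectedMartingale (hZm : ∀ n, StronglyMeasurable[𝒢 n] (Z n))
    (hA : ∀ n, MeasurableSet[𝒢 n] (A n)) (n : ℕ) :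
    StronglyMeasurable[𝒢 n] (selectedMartingale P 𝒢 Z A n) := by
  refine Finset.stronglyMeasurable_fun_sum _ fun l hl => ?_
  have hl := Finset.mem_range.1 hl
  exact ((((hZm (l + 1)).mono (𝒢.mono hl)).sub ((hZm l).mono (𝒢.mono hl.le))).add
    (stronglyMeasurable_compensatorIncrement hl.le)).indicator (𝒢.mono hl.le _ (hA l))

theorem martingale_selectedMartingale (hZm : ∀ n, StronglyMeasurable[𝒢 n] (Z n))
    (hZ2 : ∀ n, MemLp (Z n) 2 P) (hA : ∀ n, MeasurableSet[𝒢 n] (A n)) :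
    Martingale (selectedMartingale P 𝒢 Z A) 𝒢 P := by
  refine martingale_of_condExp_sub_eq_zero_nat (stronglyMeasurable_selectedMartingale hZm hA)
    (fun n => (memLp_selectedMartingale hZ2 hA n).integrable (by norm_num)) fun n => ?_
  have hD : Integrable (Z (n + 1) - Z n) P :=
    ((hZ2 (n + 1)).sub (hZ2 n)).integrable (by norm_num)
  have hp : Integrable (compensatorIncrement P 𝒢 Z n) P := integrable_condExp
  have h1 : selectedMartingale P 𝒢 Z A (n + 1) - selectedMartingale P 𝒢 Z A n =
      (A n).indicator (Z (n + 1) - Z n + compensatorIncrement P 𝒢 Z n) := by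
    ext ω
    simp only [selectedMartingale, Pi.sub_apply, Finset.sum_range_succ, add_sub_cancel_left]
    rfl
  rw [h1]
  have h2 := condExp_indicator (hD.add hp) (hA n) (μ := P) (m := 𝒢 n)
  have h3 := condExp_add hD hp (𝒢 n)
  have h4 : P[compensatorIncrement P 𝒢 Z n | 𝒢 n] = compensatorIncrement P 𝒢 Z n :=
    condExp_of_stronglyMeasurable (𝒢.le n) (stronglyMeasurable_compensatorIncrement le_rfl) hp
  have h5 : P[Z (n + 1) - Z n | 𝒢 n] =ᵐ[P] -compensatorIncrement P 𝒢 Z n := by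
    rw [compensatorIncrement, ← neg_sub (Z n)]
    exact condExp_neg _ _
  filter_upwards [h2, h3, h5] with ω h2 h3 h5
  rw [h2]
  by_cases hω : ω ∈ A n
  · rw [Set.indicator_of_mem hω, h3, Pi.add_apply, h4, h5]
    simp
  · rw [Set.indicator_of_notMem hω]
    rfl

/-- Orthogonality of martingale increments: the selection can only decrease the energy, and the
energy of a full step is at most `E Z_{n+1}² - E Z_n² + 2 E[W p_n]`. Summation leaves `E W² + 2 E[W
K]`, and `2 W K ≤ W² + K²` with the compensator bound gives `1 + 1 + 16 = 18`. -/
theorem integral_sq_selectedMartingale_le (hZ : Supermartingale Z 𝒢 P) (hW : MemLp W 2 P)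
    (hZW : ∀ n ω, |Z n ω| ≤ W ω) (hA : ∀ n, MeasurableSet[𝒢 n] (A n)) (n : ℕ) :
    ∫ ω, selectedMartingale P 𝒢 Z A n ω ^ 2 ∂P ≤ 18 * ∫ ω, W ω ^ 2 ∂P := by
  have hZ2 := memLp_two_of_abs_le hZ.1 hW hZW
  have hp2 := memLp_compensatorIncrement (𝒢 := 𝒢) hZ2
  set p := compensatorIncrement P 𝒢 Z with hp
  have hWp : ∀ l, Integrable (fun ω => W ω * p l ω) P := fun l => hW.integrable_mul (hp2 l)
  have key : ∀ n, ∫ ω, selectedMartingale P 𝒢 Z A n ω ^ 2 ∂P ≤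
      ∫ ω, Z n ω ^ 2 ∂P - ∫ ω, Z 0 ω ^ 2 ∂P +
        2 * ∑ l ∈ Finset.range n, ∫ ω, W ω * p l ω ∂P := by
    intro n
    induction n with
    | zero => simp [selectedMartingale]
    | succ n ih =>
      set N := selectedMartingale P 𝒢 Z A n with hN
      have hNm : StronglyMeasurable[𝒢 n] N := stronglyMeasurable_selectedMartingale hZ.1 hA n
      have hN2 : MemLp N 2 P := memLp_selectedMartingale hZ2 hA n
      have hD2 : MemLp (fun ω => Z n ω - Z (n + 1) ω) 2 P := (hZ2 n).sub (hZ2 (n + 1))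
      have hAn := 𝒢.le n _ (hA n)
      have hIN : MemLp ((A n).indicator N) 2 P := hN2.indicator hAn
      have e1 := integral_mul_compensatorIncrement hZ2 (hNm.indicator (hA n)) hIN
      have e2 := integral_mul_compensatorIncrement hZ2
        (stronglyMeasurable_compensatorIncrement (Z := Z) (P := P) (𝒢 := 𝒢) (le_refl n)) (hp2 n)
      have e3 := integral_mul_compensatorIncrement hZ2 (hZ.1 n) (hZ2 n)
      rw [← hp] at e1 e2 e3
      have i1 := hIN.integrable_mul (hp2 n)
      have i2 := hIN.integrable_mul hD2
      have i3 := (hp2 n).integrable_mul (hp2 n)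
      have i4 := (hp2 n).integrable_mul hD2
      have i5 := (hZ2 n).integrable_mul (hp2 n)
      have i6 := (hZ2 n).integrable_mul hD2
      have i7 := hN2.integrable_sq
      have i8 := (hZ2 n).integrable_sq
      have i9 := (hZ2 (n + 1)).integrable_sq
      -- `j0` to `j4` are the nested partial sums of the integrand in `h1`, in the order in which
      -- the integral is split below.
      have j0 := (i1.const_mul 2).sub (i2.const_mul 2)
      have j1 := i7.add j0
      have j2 := j1.add (i3.sub i4)
      have j3 := j2.add (i9.sub i8)
      have j4 := j3.add (i6.const_mul 2)
      -- With `D = Z n - Z (n + 1)`, the square `(p - D)²` is written with `D² = Z_{n+1}² - Z_n² + 2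
      -- Z_n D`. Then `e1` cancels the cross term, `e2` replaces `p D` by `p²` and `e3` replaces
      -- `Z_n D` by `Z_n p`. Off `A n` the square is added for free, whence the inequality.
      have h1 : ∫ ω, selectedMartingale P 𝒢 Z A (n + 1) ω ^ 2 ∂P ≤
          ∫ ω, (N ω ^ 2 + (2 * ((A n).indicator N ω * p n ω)
            - 2 * ((A n).indicator N ω * (Z n ω - Z (n + 1) ω)))
            + (p n ω * p n ω - p n ω * (Z n ω - Z (n + 1) ω))
            + (Z (n + 1) ω ^ 2 - Z n ω ^ 2) + 2 * (Z n ω * (Z n ω - Z (n + 1) ω))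
            - (p n ω * (Z n ω - Z (n + 1) ω))) ∂P := by
        refine integral_mono (memLp_selectedMartingale hZ2 hA (n + 1)).integrable_sq (j4.sub i4)
          fun ω => ?_
        have hsucc : selectedMartingale P 𝒢 Z A (n + 1) ω =
            N ω + (A n).indicator (fun ω => Z (n + 1) ω - Z n ω + p n ω) ω := by
          simp only [selectedMartingale, Finset.sum_range_succ, hN, hp]
        simp only [hsucc]
        by_cases hω : ω ∈ A n
        · simp only [Set.indicator_of_mem hω]
          nlinarith
        · simp only [Set.indicator_of_notMem hω]
          nlinarith [sq_nonneg (Z (n + 1) ω - Z n ω + p n ω)]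
      have h2 : ∫ ω, Z n ω * p n ω ∂P ≤ ∫ ω, W ω * p n ω ∂P := by
        refine integral_mono_ae i5 (hWp n) ?_
        filter_upwards [compensatorIncrement_nonneg hZ n] with ω hω
        exact mul_le_mul_of_nonneg_right ((le_abs_self _).trans (hZW n ω)) hω
      have h3 : 0 ≤ ∫ ω, p n ω * p n ω ∂P := integral_nonneg fun ω => mul_self_nonneg _
      rw [integral_sub, integral_add, integral_add, integral_add, integral_add, integral_sub,
        integral_sub, integral_sub, integral_const_mul, integral_const_mul,
        integral_const_mul] at h1
      · rw [Finset.sum_range_succ]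
        linarith
      all_goals first
        | exact j4 | exact j3 | exact j2 | exact j1 | exact j0 | exact i4 | exact i3 | exact i7
        | exact i8 | exact i9 | exact i3.sub i4 | exact i9.sub i8 | exact i6.const_mul 2
        | exact i1.const_mul 2 | exact i2.const_mul 2
  have hK2 : MemLp (fun ω => ∑ l ∈ Finset.range n, p l ω) 2 P :=
    memLp_finsetSum _ fun j _ => hp2 j
  have h1 : ∫ ω, Z n ω ^ 2 ∂P ≤ ∫ ω, W ω ^ 2 ∂P :=
    integral_mono (hZ2 n).integrable_sq hW.integrable_sq fun ω => by
      simpa using sq_le_sq.2 ((hZW n ω).trans (le_abs_self _))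
  have h2 : 0 ≤ ∫ ω, Z 0 ω ^ 2 ∂P := integral_nonneg fun ω => sq_nonneg _
  have h3 : 2 * ∑ l ∈ Finset.range n, ∫ ω, W ω * p l ω ∂P ≤
      ∫ ω, W ω ^ 2 ∂P + ∫ ω, (∑ l ∈ Finset.range n, p l ω) ^ 2 ∂P := by
    rw [← integral_finsetSum _ fun l _ => hWp l, ← integral_const_mul,
      ← integral_add hW.integrable_sq hK2.integrable_sq]
    refine integral_mono ((integrable_finsetSum _ fun l _ => hWp l).const_mul 2)
      (hW.integrable_sq.add hK2.integrable_sq) fun ω => ?_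
    rw [← Finset.mul_sum]
    nlinarith [sq_nonneg (W ω - ∑ l ∈ Finset.range n, p l ω)]
  have h4 := integral_sq_compensator_le hZ hW hZW n
  linarith [key n]

/-- Partial sums of selected increments of an `L²`-dominated supermartingale are dominated by a
martingale that converges almost surely and in mean. -/
theorem exists_limit_selectedMartingale (hZ : Supermartingale Z 𝒢 P) (hW : MemLp W 2 P)
    (hZW : ∀ n ω, |Z n ω| ≤ W ω) (hA : ∀ n, MeasurableSet[𝒢 n] (A n)) :
    ∃ L : Ω → ℝ, Integrable L P ∧ ∫ ω, L ω ∂P = 0 ∧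
      ∀ᵐ ω ∂P, Tendsto (fun n => selectedMartingale P 𝒢 Z A n ω) atTop (𝓝 (L ω)) := by
  have hZ2 := memLp_two_of_abs_le hZ.1 hW hZW
  have hM := martingale_selectedMartingale hZ.1 hZ2 hA (P := P)
  have hU := uniformIntegrable_of_integral_sq_le (memLp_selectedMartingale hZ2 hA)
    (integral_sq_selectedMartingale_le hZ hW hZW hA)
  obtain ⟨R, hR⟩ := hU.2.2
  refine ⟨_,
    (hM.submartingale.memLp_limitProcess hR).integrable le_rfl, ?_,
    hM.submartingale.ae_tendsto_limitProcess_of_uniformIntegrable hU⟩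
  have h := hM.ae_eq_condExp_limitProcess hU 0
  rw [← integral_condExp (𝒢.le 0), ← integral_congr_ae h]
  simp [selectedMartingale]

theorem sum_indicator_le_selectedMartingale (hZ : Supermartingale Z 𝒢 P) :
    ∀ᵐ ω ∂P, ∀ n, ∑ l ∈ Finset.range n, (A l).indicator (fun ω => Z (l + 1) ω - Z l ω) ω ≤
      selectedMartingale P 𝒢 Z A n ω := by
  filter_upwards [ae_all_iff.2 (compensatorIncrement_nonneg hZ)] with ω hω n
  refine Finset.sum_le_sum fun l _ => Set.indicator_le_indicator ?_
  have : 0 ≤ compensatorIncrement P 𝒢 Z l ω := hω l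
  linarith

/-- The absence of drift on `A n` says that the compensator increment vanishes almost surely there.
-/
theorem sum_indicator_eq_selectedMartingale (hZi : ∀ n, Integrable (Z n) P)
    (hA : ∀ n, MeasurableSet[𝒢 n] (A n))
    (h0 : ∀ n B, MeasurableSet[𝒢 n] B → ∫ ω in B ∩ A n, (Z (n + 1) ω - Z n ω) ∂P = 0) :
    ∀ᵐ ω ∂P, ∀ n, ∑ l ∈ Finset.range n, (A l).indicator (fun ω => Z (l + 1) ω - Z l ω) ω =
      selectedMartingale P 𝒢 Z A n ω := by
  have h : ∀ n, (A n).indicator (compensatorIncrement P 𝒢 Z n) =ᵐ[P] 0 := by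
    intro n
    have hD : Integrable (Z n - Z (n + 1)) P := (hZi n).sub (hZi (n + 1))
    have hAn := 𝒢.le n _ (hA n)
    have h1 := condExp_indicator hD (hA n) (μ := P) (m := 𝒢 n)
    refine h1.symm.trans (EventuallyEq.symm ?_)
    refine ae_eq_condExp_of_forall_setIntegral_eq (𝒢.le n) (hD.indicator hAn)
      (fun _ _ _ => integrableOn_zero) (fun B hB _ => ?_) aestronglyMeasurable_zero
    rw [setIntegral_indicator hAn]
    have h2 := h0 n B hB
    have h3 : ∫ ω in B ∩ A n, (Z n - Z (n + 1)) ω ∂P =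
        -∫ ω in B ∩ A n, (Z (n + 1) ω - Z n ω) ∂P := by
      rw [← integral_neg]
      exact integral_congr_ae (ae_of_all _ fun ω => by simp)
    rw [h3, h2]
    simp
  filter_upwards [ae_all_iff.2 h] with ω hω n
  refine Finset.sum_congr rfl fun l _ => ?_
  have := hω l
  by_cases hl : ω ∈ A l
  · rw [Set.indicator_of_mem hl] at this
    simp only [Set.indicator_of_mem hl, this]
    simp
  · simp only [Set.indicator_of_notMem hl]

end DiscreteTime

end OptimalSwitching

namespace OptimalSwitching

/-! ### Optional stopping and first zeros of continuous processes. -/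

section StoppingTimes

open Filter Topology

set_option linter.unusedSectionVars false

variable {T : ℝ} {Ω : Type*} {mΩ : MeasurableSpace Ω} {F : Filtration (Time T) mΩ}

theorem isStopping_iff {τ : Ω → Time T} :
    IsStopping F τ ↔ ∀ t, MeasurableSet[F t] {ω | τ ω ≤ t} := by
  simp only [IsStopping, IsStoppingTime, WithTop.coe_le_coe]

theorem isStopping_const (t : Time T) : IsStopping F fun _ : Ω => t :=
  isStoppingTime_const F t

theorem IsStopping.min {σ τ : Ω → Time T} (hσ : IsStopping F σ) (hτ : IsStopping F τ) :
    IsStopping F fun ω => min (σ ω) (τ ω) := by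
  have := IsStoppingTime.min hσ hτ
  simpa only [IsStopping, WithTop.coe_min] using this

theorem IsStopping.measurable {τ : Ω → Time T} (hτ : IsStopping F τ) : Measurable τ :=
  measurable_of_Iic fun t => F.le t _ (isStopping_iff.1 hτ t)

theorem IsStopping.measurableSet_inter {σ : Ω → Time T} (hσ : IsStopping F σ) {A : Set Ω}
    (hA : MeasurableSet[IsStoppingTime.measurableSpace hσ] A) (t : Time T) :
    MeasurableSet[F t] (A ∩ {ω | σ ω ≤ t}) := by
  simpa only [WithTop.coe_le_coe] using hA.2 t

theorem IsStopping.mono_measurableSpace {σ τ : Ω → Time T} (hσ : IsStopping F σ)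
    (hτ : IsStopping F τ) (h : ∀ ω, σ ω ≤ τ ω) :
    IsStoppingTime.measurableSpace hσ ≤ IsStoppingTime.measurableSpace hτ :=
  IsStoppingTime.measurableSpace_mono hσ hτ fun ω => WithTop.coe_le_coe.2 (h ω)

theorem IsStopping.measurableSpace_le {σ : Ω → Time T} (hσ : IsStopping F σ) :
    IsStoppingTime.measurableSpace hσ ≤ mΩ :=
  IsStoppingTime.measurableSpace_le hσ

variable [Fact (0 ≤ T)]

theorem IsStopping.measurableSet_lt {σ τ : Ω → Time T} (hσ : IsStopping F σ)
    (hτ : IsStopping F τ) : MeasurableSet[IsStoppingTime.measurableSpace hσ] {ω | σ ω < τ ω} := by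
  have h := (IsStoppingTime.measurableSet_stopping_time_le hτ hσ).compl
  convert h using 1
  ext ω
  simp

theorem IsStopping.measurable_eval {σ : Ω → Time T} (hσ : IsStopping F σ)
    {w : Time T → Ω → ℝ} (hw : IsStronglyProgressive F w) :
    Measurable[IsStoppingTime.measurableSpace hσ] fun ω => w (σ ω) ω := by
  have h := measurable_stoppedValue hw hσ
  have e : stoppedValue w (fun ω => (σ ω : WithTop (Time T))) = fun ω => w (σ ω) ω := by
    ext ω
    simp [stoppedValue]
  rwa [e] at h

/-- The points of the uniform grid with `N + 1` steps. -/
noncomputable def grid (T : ℝ) [Fact (0 ≤ T)] (N j : ℕ) : Time T :=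
  Set.projIcc 0 T Fact.out (T * j / (N + 1))

/-- The index of the first grid point after `s`. -/
noncomputable def gridIndex (N : ℕ) (s : Time T) : ℕ := ⌈(s : ℝ) * (N + 1) / T⌉₊

/-- The first grid point after `s`. -/
noncomputable def gridCeil (N : ℕ) (s : Time T) : Time T := grid T N (gridIndex N s)

theorem grid_mono (N : ℕ) : Monotone (grid T N) := by
  intro i j hij
  have hT : 0 ≤ T := Fact.out
  refine Set.monotone_projIcc _ ?_
  have : (i : ℝ) ≤ j := by exact_mod_cast hij
  gcongr

theorem coe_grid {N j : ℕ} (hj : j ≤ N + 1) : (grid T N j : ℝ) = T * j / (N + 1) := by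
  have hT : 0 ≤ T := Fact.out
  have hj' : (j : ℝ) ≤ N + 1 := by exact_mod_cast hj
  rw [grid, Set.projIcc_of_mem]
  refine ⟨by positivity, ?_⟩
  rw [div_le_iff₀ (by positivity)]
  exact mul_le_mul_of_nonneg_left hj' hT

theorem gridIndex_le (hT : 0 < T) (N : ℕ) (s : Time T) : gridIndex N s ≤ N + 1 := by
  refine Nat.ceil_le.2 ?_
  rw [div_le_iff₀ hT]
  push_cast
  nlinarith [s.2.2]

/-- This adjunction reduces events about the rounded time to events `s ≤ grid T N j`, which are
observable at the grid point; hence rounding upwards preserves stopping times. -/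
theorem gridIndex_le_iff (hT : 0 < T) {N j : ℕ} (hj : j ≤ N + 1) (s : Time T) :
    gridIndex N s ≤ j ↔ s ≤ grid T N j := by
  rw [gridIndex, Nat.ceil_le, ← Subtype.coe_le_coe, coe_grid hj, div_le_iff₀ hT,
    le_div_iff₀ (by positivity), mul_comm T]

theorem le_gridCeil (hT : 0 < T) (N : ℕ) (s : Time T) : s ≤ gridCeil N s :=
  (gridIndex_le_iff hT (gridIndex_le hT N s) s).1 le_rfl

theorem gridCeil_le_iff (hT : 0 < T) {N : ℕ} {s t : Time T} :
    gridCeil N s ≤ t ↔ ∃ j ≤ N + 1, grid T N j ≤ t ∧ s ≤ grid T N j := by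
  constructor
  · intro h
    exact ⟨_, gridIndex_le hT N s, h, le_gridCeil hT N s⟩
  · rintro ⟨j, hj, hjt, hsj⟩
    exact (grid_mono N ((gridIndex_le_iff hT hj s).2 hsj)).trans hjt

theorem tendsto_gridCeil (hT : 0 < T) (s : Time T) :
    Tendsto (fun N => gridCeil N s) atTop (𝓝 s) := by
  rw [tendsto_subtype_rng]
  have h1 : Tendsto (fun N : ℕ => (s : ℝ) + T * (1 / ((N : ℝ) + 1))) atTop (𝓝 (s + T * 0)) :=
    tendsto_const_nhds.add (tendsto_one_div_add_atTop_nhds_zero_nat.const_mul T)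
  rw [mul_zero, add_zero] at h1
  refine tendsto_of_tendsto_of_tendsto_of_le_of_le tendsto_const_nhds h1
    (fun N => le_gridCeil hT N s) fun N => ?_
  have h2 : ((gridIndex N s : ℕ) : ℝ) < (s : ℝ) * (N + 1) / T + 1 :=
    Nat.ceil_lt_add_one (div_nonneg (mul_nonneg s.2.1 (by positivity)) hT.le)
  have hN : (0 : ℝ) < N + 1 := by positivity
  simp only [gridCeil]
  rw [coe_grid (gridIndex_le hT N s), div_le_iff₀ hN]
  have h3 : T * (gridIndex N s : ℝ) ≤ T * ((s : ℝ) * (N + 1) / T + 1) :=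
    mul_le_mul_of_nonneg_left h2.le hT.le
  calc T * (gridIndex N s : ℝ) ≤ T * ((s : ℝ) * (N + 1) / T + 1) := h3
    _ = ((s : ℝ) + T * (1 / (N + 1))) * (N + 1) := by field_simp

theorem IsStopping.gridCeil (hT : 0 < T) {σ : Ω → Time T} (hσ : IsStopping F σ) (N : ℕ) :
    IsStopping F fun ω => gridCeil N (σ ω) := by
  refine isStopping_iff.2 fun t => ?_
  have : {ω | OptimalSwitching.gridCeil N (σ ω) ≤ t} =
      ⋃ j : ℕ, ⋃ _ : j ≤ N + 1 ∧ grid T N j ≤ t, {ω | σ ω ≤ grid T N j} := by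
    ext ω
    simp only [Set.mem_ofPred_eq, Set.mem_iUnion, gridCeil_le_iff hT]
    constructor
    · rintro ⟨j, h1, h2, h3⟩
      exact ⟨j, ⟨h1, h2⟩, h3⟩
    · rintro ⟨j, ⟨h1, h2⟩, h3⟩
      exact ⟨j, h1, h2, h3⟩
  rw [this]
  exact MeasurableSet.iUnion fun j => MeasurableSet.iUnion fun hj =>
    F.mono hj.2 _ (isStopping_iff.1 hσ _)

theorem measurable_eval {w : Time T → Ω → ℝ} (hw : ∀ t, Measurable (w t))
    (hc : ∀ ω, Continuous fun t => w t ω) {τ : Ω → Time T} (hτ : Measurable τ) :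
    Measurable fun ω => w (τ ω) ω :=
  (measurable_uncurry_of_continuous_of_measurable hc hw).comp (hτ.prodMk measurable_id)

variable {P : Measure Ω} [IsProbabilityMeasure P] {Z : Time T → Ω → ℝ} {W : Ω → ℝ}

theorem integrable_eval (hZm : ∀ t, Measurable (Z t)) (hZc : ∀ ω, Continuous fun t => Z t ω)
    (hW : Integrable W P) (hZW : ∀ t ω, |Z t ω| ≤ W ω) {τ : Ω → Time T} (hτ : Measurable τ) :
    Integrable (fun ω => Z (τ ω) ω) P :=
  hW.mono' (measurable_eval hZm hZc hτ).aestronglyMeasurable (ae_of_all _ fun ω => hZW _ ω)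

theorem tendsto_setIntegral_eval (hZm : ∀ t, Measurable (Z t))
    (hZc : ∀ ω, Continuous fun t => Z t ω) (hW : Integrable W P) (hZW : ∀ t ω, |Z t ω| ≤ W ω)
    {A : Set Ω} {τ : ℕ → Ω → Time T} {τ' : Ω → Time T} (hτ : ∀ n, Measurable (τ n))
    (hlim : ∀ᵐ ω ∂P.restrict A, Tendsto (fun n => τ n ω) atTop (𝓝 (τ' ω))) :
    Tendsto (fun n => ∫ ω in A, Z (τ n ω) ω ∂P) atTop (𝓝 (∫ ω in A, Z (τ' ω) ω ∂P)) := by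
  refine tendsto_integral_of_dominated_convergence W
    (fun n => (measurable_eval hZm hZc (hτ n)).aestronglyMeasurable) hW.integrableOn
    (fun n => ae_of_all _ fun ω => hZW _ ω) ?_
  filter_upwards [hlim] with ω hω
  exact ((hZc ω).tendsto _).comp hω

/-- **Optional stopping** for continuous supermartingales dominated by an integrable function. -/
theorem setIntegral_stopped_le (hT : 0 < T) (hZm : ∀ t, Measurable (Z t))
    (hZc : ∀ ω, Continuous fun t => Z t ω) (hW : Integrable W P) (hZW : ∀ t ω, |Z t ω| ≤ W ω)
    (hZ : ∀ s t, s ≤ t → ∀ A, MeasurableSet[F s] A → ∫ ω in A, (Z t ω - Z s ω) ∂P ≤ 0)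
    {σ τ : Ω → Time T} (hσ : IsStopping F σ) (hτ : IsStopping F τ) (hστ : ∀ ω, σ ω ≤ τ ω)
    {A : Set Ω} (hA : MeasurableSet[IsStoppingTime.measurableSpace hσ] A) :
    ∫ ω in A, (Z (τ ω) ω - Z (σ ω) ω) ∂P ≤ 0 := by
  have hint := fun {τ : Ω → Time T} (hτ : Measurable τ) =>
    integrable_eval hZm hZc hW hZW hτ (P := P)
  have hAm : MeasurableSet A := hσ.measurableSpace_le _ hA
  have hgrid : ∀ N, ∫ ω in A, (Z (gridCeil N (τ ω)) ω - Z (gridCeil N (σ ω)) ω) ∂P ≤ 0 := by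
    intro N
    have hD : ∀ j, Integrable (fun ω => Z (grid T N (j + 1)) ω - Z (grid T N j) ω) P := fun j =>
      (hint measurable_const).sub (hint measurable_const)
    -- On `E j` the `j`-th grid step lies between the rounded times. Since `A ∩ E j` is known at the
    -- left endpoint of that step, the hypothesis at deterministic times applies to each step.
    set E : ℕ → Set Ω := fun j => {ω | σ ω ≤ grid T N j} ∩ {ω | τ ω ≤ grid T N j}ᶜ with hE
    have hEm : ∀ j, MeasurableSet[F (grid T N j)] (A ∩ E j) := fun j => by
      rw [hE, ← Set.inter_assoc]
      exact (hσ.measurableSet_inter hA _).inter (isStopping_iff.1 hτ _).compl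
    have hEm' : ∀ j, MeasurableSet (E j) := fun j =>
      (F.le _ _ (isStopping_iff.1 hσ _)).inter (F.le _ _ (isStopping_iff.1 hτ _)).compl
    have hsum : ∀ ω, Z (gridCeil N (τ ω)) ω - Z (gridCeil N (σ ω)) ω =
        ∑ j ∈ Finset.range (N + 1),
          (E j).indicator (fun ω => Z (grid T N (j + 1)) ω - Z (grid T N j) ω) ω := by
      intro ω
      have hle : gridIndex N (σ ω) ≤ gridIndex N (τ ω) :=
        (gridIndex_le_iff hT (gridIndex_le hT N _) _).2 ((hστ ω).trans (le_gridCeil hT N _))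
      rw [gridCeil, gridCeil, ← Finset.sum_Ico_sub (fun j => Z (grid T N j) ω) hle]
      have hsub : Finset.Ico (gridIndex N (σ ω)) (gridIndex N (τ ω)) =
          (Finset.range (N + 1)).filter fun j =>
            gridIndex N (σ ω) ≤ j ∧ ¬ gridIndex N (τ ω) ≤ j := by
        ext j
        have := gridIndex_le hT N (τ ω)
        simp only [Finset.mem_Ico, Finset.mem_filter, Finset.mem_range]
        omega
      rw [hsub, Finset.sum_filter]
      refine Finset.sum_congr rfl fun j hj => ?_
      have hj' : j ≤ N + 1 := (Finset.mem_range.1 hj).le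
      have hiff : ω ∈ E j ↔ gridIndex N (σ ω) ≤ j ∧ ¬ gridIndex N (τ ω) ≤ j := by
        rw [gridIndex_le_iff hT hj', gridIndex_le_iff hT hj']
        rfl
      by_cases h : ω ∈ E j
      · rw [if_pos (hiff.1 h), Set.indicator_of_mem h]
      · rw [if_neg (hiff.not.1 h), Set.indicator_of_notMem h]
    simp only [hsum]
    rw [integral_finsetSum _ fun j _ => ((hD j).indicator (hEm' j)).integrableOn]
    refine Finset.sum_nonpos fun j _ => ?_
    rw [setIntegral_indicator (hEm' j)]
    exact hZ _ _ (grid_mono N j.le_succ) _ (hEm j)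
  have hlim : Tendsto
      (fun N => ∫ ω in A, (Z (gridCeil N (τ ω)) ω - Z (gridCeil N (σ ω)) ω) ∂P) atTop
      (𝓝 (∫ ω in A, (Z (τ ω) ω - Z (σ ω) ω) ∂P)) := by
    have h := fun {τ : Ω → Time T} (hτ : IsStopping F τ) =>
      tendsto_setIntegral_eval (A := A) hZm hZc hW hZW (fun N => (hτ.gridCeil hT N).measurable)
        (ae_of_all _ fun ω => tendsto_gridCeil hT (τ ω))
    rw [integral_sub (hint hτ.measurable).integrableOn (hint hσ.measurable).integrableOn]
    refine ((h hτ).sub (h hσ)).congr fun N => ?_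
    exact (integral_sub (hint (hτ.gridCeil hT N).measurable).integrableOn
      (hint (hσ.gridCeil hT N).measurable).integrableOn).symm
  exact le_of_tendsto' hlim hgrid

/-- The first zero of `h` after time `s`, or the horizon if there is none. -/
noncomputable def firstHit (h : Time T → Ω → ℝ) (s : Time T) (ω : Ω) : Time T :=
  sInf {r | s ≤ r ∧ h r ω = 0}

variable {h : Time T → Ω → ℝ}

theorem le_firstHit (s : Time T) (ω : Ω) : s ≤ firstHit h s ω :=
  le_sInf fun _ hr => hr.1

theorem firstHit_le {s r : Time T} {ω : Ω} (hr : s ≤ r) (h0 : h r ω = 0) : firstHit h s ω ≤ r :=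
  sInf_le ⟨hr, h0⟩

theorem ne_zero_of_lt_firstHit {s r : Time T} {ω : Ω} (hr : s ≤ r) (hlt : r < firstHit h s ω) :
    h r ω ≠ 0 := fun h0 => hlt.not_ge (firstHit_le hr h0)

theorem firstHit_eq_zero (hc : ∀ ω, Continuous fun t => h t ω) {s : Time T} {ω : Ω}
    (hlt : firstHit h s ω < ⊤) : h (firstHit h s ω) ω = 0 := by
  have hne : {r | s ≤ r ∧ h r ω = 0}.Nonempty := by
    by_contra hempty
    rw [Set.not_nonempty_iff_eq_empty] at hempty
    rw [firstHit, hempty, sInf_empty] at hlt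
    exact lt_irrefl _ hlt
  have hclosed : IsClosed {r | s ≤ r ∧ h r ω = 0} :=
    isClosed_Ici.inter (isClosed_singleton.preimage (hc ω))
  exact (hclosed.csInf_mem hne (OrderBot.bddBelow _)).2

/-- There is no zero in `[s, r)`, so restarting the search at `r` changes nothing. -/
theorem firstHit_congr {s r : Time T} {ω : Ω} (hsr : s ≤ r) (hr : r ≤ firstHit h s ω) :
    firstHit h r ω = firstHit h s ω := by
  refine le_antisymm (le_sInf fun q hq => ?_) (le_sInf fun q hq => ?_)
  · exact firstHit_le (hr.trans (firstHit_le hq.1 hq.2)) hq.2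
  · exact firstHit_le (hsr.trans hq.1) hq.2

theorem firstHit_le_iff (hc : ∀ ω, Continuous fun t => h t ω) {s t : Time T} {ω : Ω}
    (ht : t < ⊤) : firstHit h s ω ≤ t ↔ ∃ r, s ≤ r ∧ r ≤ t ∧ h r ω = 0 := by
  constructor
  · intro hle
    exact ⟨_, le_firstHit s ω, hle, firstHit_eq_zero hc (hle.trans_lt ht)⟩
  · rintro ⟨r, hsr, hrt, h0⟩
    exact (firstHit_le hsr h0).trans hrt

/-- A countable criterion, when `D` is countable, that looks only at times up to `t`. Zeros before
`t` are approximated from the right, so that `s ≤ q` persists; `⊤ ∈ D` makes the endpoint `t` itself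
available. Conversely `|f|` attains its infimum `0` on the compact interval `[s, t]`. -/
theorem exists_zero_iff {f : Time T → ℝ} (hf : Continuous f) {D : Set (Time T)} (hD : Dense D)
    (htop : ⊤ ∈ D) {s t : Time T} :
    (∃ r, s ≤ r ∧ r ≤ t ∧ f r = 0) ↔
      ∀ N : ℕ, ∃ q ∈ D, s ≤ min q t ∧ |f (min q t)| < 1 / ((N : ℝ) + 1) := by
  constructor
  · rintro ⟨r, hsr, hrt, h0⟩ N
    rcases hrt.eq_or_lt with rfl | hlt
    · refine ⟨⊤, htop, by simpa using hsr, ?_⟩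
      rw [top_inf_eq, h0, abs_zero]
      positivity
    · have hopen : IsOpen {q | |f q| < 1 / ((N : ℝ) + 1)} :=
        isOpen_lt hf.abs continuous_const
      have hmem : {q | |f q| < 1 / ((N : ℝ) + 1)} ∈ 𝓝 r :=
        hopen.mem_nhds (by simp only [Set.mem_ofPred_eq, h0, abs_zero]; positivity)
      have hev : ∀ᶠ q in 𝓝[>] r, |f q| < 1 / ((N : ℝ) + 1) :=
        (mem_nhdsWithin_of_mem_nhds hmem)
      obtain ⟨u, hu, hsub⟩ := (mem_nhdsGT_iff_exists_Ioo_subset' hlt).1 hev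
      have hru : r < min u t := lt_min hu hlt
      obtain ⟨q, hqD, hq1, hq2⟩ := hD.exists_between hru
      have hqt : min q t = q := min_eq_left (hq2.le.trans (min_le_right _ _))
      refine ⟨q, hqD, ?_, ?_⟩
      · rw [hqt]
        exact hsr.trans hq1.le
      · rw [hqt]
        exact hsub ⟨hq1, hq2.trans_le (min_le_left _ _)⟩
  · intro H
    choose q hqD hq1 hq2 using H
    have hst : s ≤ t := (hq1 0).trans (min_le_right _ _)
    obtain ⟨r, hr, hmin⟩ := isCompact_Icc.exists_isMinOn (Set.nonempty_Icc.2 hst)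
      hf.abs.continuousOn
    refine ⟨r, hr.1, hr.2, ?_⟩
    have hle : ∀ N : ℕ, |f r| ≤ 1 / ((N : ℝ) + 1) := fun N =>
      (hmin (show min (q N) t ∈ Set.Icc s t from ⟨hq1 N, min_le_right _ _⟩)).trans (hq2 N).le
    have := ge_of_tendsto' tendsto_one_div_add_atTop_nhds_zero_nat hle
    exact abs_eq_zero.1 (le_antisymm this (abs_nonneg _))

/-- Because `{0}` is closed and the paths are continuous, no right-continuity of the filtration is
needed. -/
theorem isStopping_firstHit (hc : ∀ ω, Continuous fun t => h t ω)
    (hm : ∀ t, Measurable[F t] (h t)) {σ : Ω → Time T} (hσ : IsStopping F σ) :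
    IsStopping F fun ω => firstHit h (σ ω) ω := by
  refine isStopping_iff.2 fun t => ?_
  rcases eq_or_lt_of_le (le_top (a := t)) with rfl | ht
  · simp
  obtain ⟨D₀, hD₀c, hD₀⟩ := TopologicalSpace.exists_countable_dense (Time T)
  set D : Set (Time T) := insert ⊤ D₀ with hDdef
  have hDc : D.Countable := hD₀c.insert _
  have hD : Dense D := hD₀.mono (Set.subset_insert _ _)
  have : {ω | firstHit h (σ ω) ω ≤ t} = ⋂ N : ℕ, ⋃ q ∈ D,
      ({ω | σ ω ≤ min q t} ∩ {ω | |h (min q t) ω| < 1 / ((N : ℝ) + 1)}) := by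
    ext ω
    simp only [Set.mem_ofPred_eq, firstHit_le_iff hc ht,
      exists_zero_iff (hc ω) hD (Set.mem_insert _ _), Set.mem_iInter, Set.mem_iUnion,
      Set.mem_inter_iff, exists_prop]
  rw [this]
  refine MeasurableSet.iInter fun N => MeasurableSet.biUnion hDc fun q _ => ?_
  refine (F.mono (min_le_right q t) _ (isStopping_iff.1 hσ _)).inter
    (F.mono (min_le_right q t) _ ?_)
  exact hm _ (isOpen_lt continuous_abs continuous_const).measurableSet

/-- If `Z` is a martingale between every deterministic time and the next zero of `h`, then it is one
between every stopping time and the next zero of `h`. -/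
theorem setIntegral_firstHit_stopped (hT : 0 < T) (hZm : ∀ t, Measurable (Z t))
    (hZc : ∀ ω, Continuous fun t => Z t ω) (hW : Integrable W P) (hZW : ∀ t ω, |Z t ω| ≤ W ω)
    (hc : ∀ ω, Continuous fun t => h t ω) (hm : ∀ t, Measurable[F t] (h t))
    (hZ : ∀ t A, MeasurableSet[F t] A → ∫ ω in A, (Z (firstHit h t ω) ω - Z t ω) ∂P = 0)
    {σ : Ω → Time T} (hσ : IsStopping F σ) {A : Set Ω}
    (hA : MeasurableSet[IsStoppingTime.measurableSpace hσ] A) :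
    ∫ ω in A, (Z (firstHit h (σ ω) ω) ω - Z (σ ω) ω) ∂P = 0 := by
  have hint := fun {τ : Ω → Time T} (hτ : Measurable τ) =>
    integrable_eval hZm hZc hW hZW hτ (P := P)
  have hρ := isStopping_firstHit hc hm hσ
  -- Rounding `σ` up would miss a zero at `σ` itself, but there the increment is zero. On `A'` the
  -- rounded time is eventually before the next zero, and from then on leads to the same zero.
  set A' := A ∩ {ω | σ ω < firstHit h (σ ω) ω} with hA'
  have hA'm : MeasurableSet[IsStoppingTime.measurableSpace hσ] A' :=
    hA.inter (hσ.measurableSet_lt hρ)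
  have hA'm0 : MeasurableSet A' := hσ.measurableSpace_le _ hA'm
  have hAA' : ∫ ω in A, (Z (firstHit h (σ ω) ω) ω - Z (σ ω) ω) ∂P =
      ∫ ω in A', (Z (firstHit h (σ ω) ω) ω - Z (σ ω) ω) ∂P := by
    refine setIntegral_eq_of_subset_of_forall_sdiff_eq_zero (hσ.measurableSpace_le _ hA)
      Set.inter_subset_left fun ω hω => ?_
    have h1 : ¬ σ ω < firstHit h (σ ω) ω := fun hlt => hω.2 ⟨hω.1, hlt⟩
    rw [le_antisymm (not_lt.1 h1) (le_firstHit _ _), sub_self]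
  rw [hAA']
  have hgrid : ∀ N, ∫ ω in A', (Z (firstHit h (gridCeil N (σ ω)) ω) ω - Z (gridCeil N (σ ω)) ω) ∂P
      = 0 := by
    intro N
    -- On `E j` the rounded time is the deterministic `grid T N j`, so `hZ` applies.
    set E : ℕ → Set Ω := fun j => {ω | gridIndex N (σ ω) = j} with hE
    have hEm : ∀ j ≤ N + 1, MeasurableSet[F (grid T N j)] (A' ∩ E j) := by
      intro j hj
      have : A' ∩ E j = (A' ∩ {ω | σ ω ≤ grid T N j}) ∩
          ⋂ l : ℕ, ⋂ _ : l < j, {ω | σ ω ≤ grid T N l}ᶜ := by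
        ext ω
        simp only [hE, Set.mem_inter_iff, Set.mem_ofPred_eq, Set.mem_iInter, Set.mem_compl_iff,
          ← gridIndex_le_iff hT hj, and_assoc]
        refine and_congr_right fun _ => ?_
        have hrw : (∀ l, l < j → ¬ σ ω ≤ grid T N l) ↔ ∀ l, l < j → ¬ gridIndex N (σ ω) ≤ l :=
          forall₂_congr fun l hl => by rw [gridIndex_le_iff hT (hl.le.trans hj)]
        rw [hrw]
        constructor
        · rintro rfl
          exact ⟨le_rfl, fun l hl => not_le.2 hl⟩
        · rintro ⟨h1, h2⟩
          by_contra hne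
          exact h2 _ (lt_of_le_of_ne h1 hne) le_rfl
      rw [this]
      exact (hσ.measurableSet_inter hA'm _).inter (MeasurableSet.iInter fun l =>
        MeasurableSet.iInter fun hl => (F.mono (grid_mono N hl.le) _
          (isStopping_iff.1 hσ _)).compl)
    have hcover : A' = ⋃ j ∈ Finset.range (N + 2), A' ∩ E j := by
      ext ω
      simp only [Set.mem_iUnion, Finset.mem_range, Set.mem_inter_iff, hE, Set.mem_ofPred_eq]
      constructor
      · intro hω
        exact ⟨_, Nat.lt_succ_of_le (gridIndex_le hT N (σ ω)), hω, rfl⟩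
      · rintro ⟨j, -, hω, -⟩
        exact hω
    have hi : Integrable
        (fun ω => Z (firstHit h (gridCeil N (σ ω)) ω) ω - Z (gridCeil N (σ ω)) ω) P :=
      (hint (isStopping_firstHit hc hm (hσ.gridCeil hT N)).measurable).sub
        (hint (hσ.gridCeil hT N).measurable)
    have hmE : ∀ j ∈ Finset.range (N + 2), MeasurableSet (A' ∩ E j) := fun j hj =>
      F.le _ _ (hEm j (Nat.lt_succ_iff.1 (Finset.mem_range.1 hj)))
    rw [hcover, integral_biUnion_finset _ hmE ?_ fun j _ => hi.integrableOn]
    · refine Finset.sum_eq_zero fun j hj => ?_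
      rw [← hZ (grid T N j) _ (hEm j (Nat.lt_succ_iff.1 (Finset.mem_range.1 hj)))]
      refine setIntegral_congr_fun (hmE j hj) fun ω hω => ?_
      have : gridIndex N (σ ω) = j := hω.2
      simp only [gridCeil, this]
    · intro i _ j _ hij
      refine Set.disjoint_left.2 fun ω h1 h2 => hij ?_
      exact (show gridIndex N (σ ω) = i from h1.2).symm.trans h2.2
  have hlim : Tendsto (fun N => ∫ ω in A',
      (Z (firstHit h (gridCeil N (σ ω)) ω) ω - Z (gridCeil N (σ ω)) ω) ∂P) atTop
      (𝓝 (∫ ω in A', (Z (firstHit h (σ ω) ω) ω - Z (σ ω) ω) ∂P)) := by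
    have h1 := tendsto_setIntegral_eval (A := A') hZm hZc hW hZW
      (fun N => (hσ.gridCeil hT N).measurable)
      (ae_of_all _ fun ω => tendsto_gridCeil hT (σ ω)) (P := P)
    have h2 := tendsto_setIntegral_eval (A := A') hZm hZc hW hZW (P := P)
      (τ' := fun ω => firstHit h (σ ω) ω)
      (fun N => (isStopping_firstHit hc hm (hσ.gridCeil hT N)).measurable) (by
        refine ae_restrict_of_forall_mem hA'm0 fun ω hω => ?_
        have hev : ∀ᶠ N in atTop, gridCeil N (σ ω) ≤ firstHit h (σ ω) ω :=
          ((tendsto_gridCeil hT (σ ω)).eventually_lt_const hω.2).mono fun _ h => h.le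
        refine tendsto_const_nhds.congr' (hev.mono fun N hN => ?_)
        exact (firstHit_congr (le_gridCeil hT N _) hN).symm)
    rw [integral_sub (hint hρ.measurable).integrableOn (hint hσ.measurable).integrableOn]
    refine (h2.sub h1).congr fun N => ?_
    exact (integral_sub
      (hint (isStopping_firstHit hc hm (hσ.gridCeil hT N)).measurable).integrableOn
      (hint (hσ.gridCeil hT N).measurable).integrableOn).symm
  exact tendsto_nhds_unique hlim (by simp only [hgrid]; exact tendsto_const_nhds)

end StoppingTimes

end OptimalSwitching

namespace OptimalSwitching

/-! ### Essential suprema of directed families. -/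

section EssentialSupremum

open Filter Topology

set_option linter.unusedSectionVars false

variable {Ω : Type*} {mΩ : MeasurableSpace Ω} {P : Measure Ω}

/-- The essential supremum of an upward directed family is approximated in mean by members of the
family. -/
theorem IsEssSup.exists_integral_le {S : Set (Ω → ℝ)} {z : Ω → ℝ} (hz : IsEssSup P S z)
    (hzi : Integrable z P) (hne : S.Nonempty) (hSm : ∀ f ∈ S, Measurable f)
    (hSi : ∀ f ∈ S, Integrable f P)
    (hdir : ∀ f ∈ S, ∀ g ∈ S, ∃ h ∈ S, f ≤ᵐ[P] h ∧ g ≤ᵐ[P] h) {ε : ℝ} (hε : 0 < ε) :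
    ∃ f ∈ S, ∫ ω, z ω ∂P ≤ ∫ ω, f ω ∂P + ε := by
  set V : Set ℝ := (fun f => ∫ ω, f ω ∂P) '' S with hV
  have hVne : V.Nonempty := hne.image _
  have hVb : BddAbove V := by
    refine ⟨∫ ω, z ω ∂P, ?_⟩
    rintro _ ⟨f, hf, rfl⟩
    exact integral_mono_ae (hSi f hf) hzi (hz.2.1 f hf)
  set c := sSup V with hc
  have hle_c : ∀ f ∈ S, ∫ ω, f ω ∂P ≤ c := fun f hf => le_csSup hVb ⟨f, hf, rfl⟩
  have happrox : ∀ n : ℕ, ∃ f ∈ S, c - 1 / ((n : ℝ) + 1) < ∫ ω, f ω ∂P := fun n => by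
    have : c - 1 / ((n : ℝ) + 1) < sSup V := by
      have : (0 : ℝ) < 1 / ((n : ℝ) + 1) := by positivity
      linarith
    obtain ⟨_, ⟨f, hf, rfl⟩, h⟩ := exists_lt_of_lt_csSup hVne this
    exact ⟨f, hf, h⟩
  choose a haS ha using happrox
  choose u huS hu1 hu2 using hdir
  -- Directedness makes a maximizing sequence increasing: `φ (n + 1)` dominates both `φ n` and `a (n
  -- + 1)`.
  let φ : ℕ → S := fun n => Nat.rec ⟨a 0, haS 0⟩
    (fun n f => ⟨u f.1 f.2 (a (n + 1)) (haS _), huS _ _ _ _⟩) n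
  have hmono : ∀ n, (φ n).1 ≤ᵐ[P] (φ (n + 1)).1 := fun n => hu1 _ _ _ _
  have hφa : ∀ n : ℕ, c - 1 / ((n : ℝ) + 1) ≤ ∫ ω, (φ n).1 ω ∂P := fun n => by
    cases n with
    | zero => exact (ha 0).le
    | succ n =>
      exact (ha (n + 1)).le.trans (integral_mono_ae (hSi _ (haS _)) (hSi _ (φ (n + 1)).2)
        (hu2 _ _ _ _))
  have hae : ∀ᵐ ω ∂P, Monotone (fun n => (φ n).1 ω) ∧ ∀ n, (φ n).1 ω ≤ z ω := by
    filter_upwards [ae_all_iff.2 hmono, ae_all_iff.2 fun n => hz.2.1 _ (φ n).2] with ω h1 h2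
    exact ⟨monotone_nat_of_le_succ h1, h2⟩
  set Φ : Ω → ℝ := fun ω => ⨆ n, (φ n).1 ω with hΦ
  have hΦm : Measurable Φ := Measurable.iSup fun n => hSm _ (φ n).2
  have hlim : ∀ᵐ ω ∂P, Tendsto (fun n => (φ n).1 ω) atTop (𝓝 (Φ ω)) := by
    filter_upwards [hae] with ω hω
    exact tendsto_atTop_ciSup hω.1 ⟨z ω, by rintro _ ⟨n, rfl⟩; exact hω.2 n⟩
  have hbound : ∀ᵐ ω ∂P, ∀ n, |(φ n).1 ω| ≤ |(φ 0).1 ω| + |z ω| := by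
    filter_upwards [hae] with ω hω n
    have h1 := hω.1 (Nat.zero_le n)
    have h2 := hω.2 n
    simp only at h1
    rw [abs_le]
    constructor
    · linarith [neg_abs_le ((φ 0).1 ω), abs_nonneg (z ω)]
    · linarith [le_abs_self (z ω), abs_nonneg ((φ 0).1 ω)]
  have hBi : Integrable (fun ω => |(φ 0).1 ω| + |z ω|) P := (hSi _ (φ 0).2).abs.add hzi.abs
  have hΦi : Integrable Φ P := by
    refine hBi.mono' hΦm.aestronglyMeasurable ?_
    filter_upwards [hlim, hbound] with ω h1 h2
    exact le_of_tendsto' h1.norm h2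
  have hΦc : c ≤ ∫ ω, Φ ω ∂P := by
    have h1 : Tendsto (fun n => ∫ ω, (φ n).1 ω ∂P) atTop (𝓝 (∫ ω, Φ ω ∂P)) :=
      tendsto_integral_of_dominated_convergence _ (fun n => (hSi _ (φ n).2).1) hBi
        (fun n => hbound.mono fun ω h => h n) hlim
    have h2 : Tendsto (fun n : ℕ => c - 1 / ((n : ℝ) + 1)) atTop (𝓝 (c - 0)) :=
      tendsto_const_nhds.sub tendsto_one_div_add_atTop_nhds_zero_nat
    rw [sub_zero] at h2
    exact le_of_tendsto_of_tendsto' h2 h1 hφa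
  -- By directedness the mean of `max Φ g` cannot exceed `c`, which `Φ` already reaches; so the two
  -- agree almost surely.
  have hΦS : ∀ g ∈ S, g ≤ᵐ[P] Φ := by
    intro g hg
    have hgi := hSi g hg
    have h1 : ∀ n, ∫ ω, max ((φ n).1 ω) (g ω) ∂P ≤ c := fun n => by
      refine le_trans (integral_mono_ae ((hSi _ (φ n).2).sup hgi)
        (hSi _ (huS _ (φ n).2 g hg)) ?_) (hle_c _ (huS _ (φ n).2 g hg))
      filter_upwards [hu1 _ (φ n).2 g hg, hu2 _ (φ n).2 g hg] with ω h1 h2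
      exact max_le h1 h2
    have h2 : Tendsto (fun n => ∫ ω, max ((φ n).1 ω) (g ω) ∂P) atTop
        (𝓝 (∫ ω, max (Φ ω) (g ω) ∂P)) := by
      refine tendsto_integral_of_dominated_convergence
        (fun ω => (|(φ 0).1 ω| + |z ω|) + |g ω|)
        (fun n => ((hSi _ (φ n).2).sup hgi).1) (hBi.add hgi.abs)
        (fun n => hbound.mono fun ω h => ?_) (hlim.mono fun ω h => h.max tendsto_const_nhds)
      refine (abs_max_le_max_abs_abs).trans (max_le ?_ ?_)
      · linarith [h n, abs_nonneg (g ω)]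
      · linarith [abs_nonneg ((φ 0).1 ω), abs_nonneg (z ω)]
    have h3 : ∫ ω, max (Φ ω) (g ω) ∂P ≤ c := le_of_tendsto' h2 h1
    have hmi : Integrable (fun ω => max (Φ ω) (g ω)) P := hΦi.sup hgi
    have h4 : ∫ ω, (max (Φ ω) (g ω) - Φ ω) ∂P = 0 := by
      refine le_antisymm ?_ (integral_nonneg fun ω => sub_nonneg.2 (le_max_left _ _))
      rw [integral_sub hmi hΦi]
      linarith
    have h5 := (integral_eq_zero_iff_of_nonneg (fun ω => sub_nonneg.2 (le_max_left _ _))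
      (hmi.sub hΦi)).1 h4
    filter_upwards [h5] with ω h5
    have h6 : max (Φ ω) (g ω) - Φ ω = 0 := h5
    linarith [le_max_right (Φ ω) (g ω)]
  have hzΦ : ∫ ω, z ω ∂P ≤ c := by
    refine (integral_mono_ae hzi hΦi (hz.2.2 Φ hΦm hΦS)).trans ?_
    have h1 : Tendsto (fun n => ∫ ω, (φ n).1 ω ∂P) atTop (𝓝 (∫ ω, Φ ω ∂P)) :=
      tendsto_integral_of_dominated_convergence _ (fun n => (hSi _ (φ n).2).1) hBi
        (fun n => hbound.mono fun ω h => h n) hlim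
    exact le_of_tendsto' h1 fun n => hle_c _ (φ n).2
  have : c - ε < sSup V := by linarith
  obtain ⟨_, ⟨f, hf, rfl⟩, h⟩ := exists_lt_of_lt_csSup hVne this
  exact ⟨f, hf, by simp only at h; linarith⟩

end EssentialSupremum

/-! ### Snell envelopes: supermartingale property and optimal stopping. -/

section SnellEnvelope

open Filter Topology

set_option linter.unusedSectionVars false

variable {T : ℝ} {Ω : Type*} {mΩ : MeasurableSpace Ω} {F : Filtration (Time T) mΩ}
  [Fact (0 ≤ T)] {P : Measure Ω} [IsProbabilityMeasure P]

open Classical in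
/-- The reward `I_τ - I_t + o_τ 1_{τ < T}`. -/
noncomputable def snellReward (I o : Time T → Ω → ℝ) (t : Time T) (τ : Ω → Time T) (ω : Ω) : ℝ :=
  I (τ ω) ω - I t ω + if τ ω < ⊤ then o (τ ω) ω else 0

/-- `y + I` is the Snell envelope of `I + o 1_{t < T}`, for continuous processes dominated by a
square integrable random variable. -/
structure IsSnellEnvelope (F : Filtration (Time T) mΩ) (P : Measure Ω)
    (y o I : Time T → Ω → ℝ) (W : Ω → ℝ) : Prop where
  continuous_value : ∀ ω, Continuous fun t => y t ω
  continuous_obstacle : ∀ ω, Continuous fun t => o t ω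
  continuous_running : ∀ ω, Continuous fun t => I t ω
  adapted_value : ∀ t, Measurable[F t] (y t)
  adapted_obstacle : ∀ t, Measurable[F t] (o t)
  adapted_running : ∀ t, Measurable[F t] (I t)
  memLp_bound : MemLp W 2 P
  value_le : ∀ t ω, |y t ω| ≤ W ω
  obstacle_le : ∀ t ω, |o t ω| ≤ W ω
  running_le : ∀ t ω, |I t ω| ≤ W ω
  isEssSup : ∀ t, IsEssSup P
    {f | ∃ τ : Ω → Time T, IsStopping F τ ∧ (∀ ω, t ≤ τ ω) ∧ f = P[snellReward I o t τ | F t]} (y t)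
  terminal : y ⊤ =ᵐ[P] 0

namespace IsSnellEnvelope

variable {y o I : Time T → Ω → ℝ} {W : Ω → ℝ}

theorem integrable_bound (h : IsSnellEnvelope F P y o I W) : Integrable W P :=
  h.memLp_bound.integrable (by norm_num)

theorem measurable_value (h : IsSnellEnvelope F P y o I W) (t : Time T) : Measurable (y t) :=
  (h.adapted_value t).mono (F.le t) le_rfl

theorem measurable_obstacle (h : IsSnellEnvelope F P y o I W) (t : Time T) : Measurable (o t) :=
  (h.adapted_obstacle t).mono (F.le t) le_rfl

theorem measurable_running (h : IsSnellEnvelope F P y o I W) (t : Time T) : Measurable (I t) :=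
  (h.adapted_running t).mono (F.le t) le_rfl

theorem integrable_value (h : IsSnellEnvelope F P y o I W) {τ : Ω → Time T} (hτ : Measurable τ) :
    Integrable (fun ω => y (τ ω) ω) P :=
  integrable_eval h.measurable_value h.continuous_value h.integrable_bound h.value_le hτ

theorem integrable_running (h : IsSnellEnvelope F P y o I W) {τ : Ω → Time T}
    (hτ : Measurable τ) : Integrable (fun ω => I (τ ω) ω) P :=
  integrable_eval h.measurable_running h.continuous_running h.integrable_bound h.running_le hτ

open Classical in
theorem integrable_terminal (h : IsSnellEnvelope F P y o I W) {τ : Ω → Time T}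
    (hτ : Measurable τ) : Integrable (fun ω => if τ ω < ⊤ then o (τ ω) ω else 0) P := by
  refine ((integrable_eval h.measurable_obstacle h.continuous_obstacle h.integrable_bound
    h.obstacle_le hτ).indicator (s := {ω | τ ω < ⊤})
      (measurableSet_lt hτ measurable_const)).congr
    (ae_of_all _ fun ω => ?_)
  exact Set.indicator_apply {ω | τ ω < ⊤} (fun ω => o (τ ω) ω) ω

theorem integrable_reward (h : IsSnellEnvelope F P y o I W) (t : Time T) {τ : Ω → Time T}
    (hτ : Measurable τ) : Integrable (snellReward I o t τ) P := by
  classical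
  exact ((h.integrable_running hτ).sub (h.integrable_running measurable_const)).add
    (h.integrable_terminal hτ)

theorem condExp_reward_le (h : IsSnellEnvelope F P y o I W) {t : Time T} {τ : Ω → Time T}
    (hτ : IsStopping F τ) (htτ : ∀ ω, t ≤ τ ω) :
    P[snellReward I o t τ | F t] ≤ᵐ[P] y t :=
  (h.isEssSup t).2.1 _ ⟨τ, hτ, htτ, rfl⟩

theorem setIntegral_reward_le (h : IsSnellEnvelope F P y o I W) {t : Time T} {τ : Ω → Time T}
    (hτ : IsStopping F τ) (htτ : ∀ ω, t ≤ τ ω) {A : Set Ω} (hA : MeasurableSet[F t] A) :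
    ∫ ω in A, snellReward I o t τ ω ∂P ≤ ∫ ω in A, y t ω ∂P := by
  rw [← setIntegral_condExp (F.le t) (h.integrable_reward t hτ.measurable) hA]
  exact setIntegral_mono_ae integrable_condExp.integrableOn
    (h.integrable_value measurable_const).integrableOn (h.condExp_reward_le hτ htτ)

/-- The conditional rewards are upward directed: two stopping times are pasted along the `F t`-event
on which the first has the larger conditional reward. -/
theorem exists_integral_le (h : IsSnellEnvelope F P y o I W) (t : Time T) {ε : ℝ} (hε : 0 < ε) :
    ∃ τ : Ω → Time T, IsStopping F τ ∧ (∀ ω, t ≤ τ ω) ∧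
      ∫ ω, y t ω ∂P ≤ ∫ ω, snellReward I o t τ ω ∂P + ε := by
  classical
  obtain ⟨_, ⟨τ, hτ, htτ, rfl⟩, hle⟩ := (h.isEssSup t).exists_integral_le
    (h.integrable_value measurable_const) ⟨_, _, isStopping_const t, fun _ => le_rfl, rfl⟩
    (by
      rintro _ ⟨τ, -, -, rfl⟩
      exact (stronglyMeasurable_condExp.mono (F.le t)).measurable)
    (by
      rintro _ ⟨τ, -, -, rfl⟩
      exact integrable_condExp)
    (by
      rintro _ ⟨τ, hτ, htτ, rfl⟩ _ ⟨σ, hσ, htσ, rfl⟩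
      set B : Set Ω := {ω | (P[snellReward I o t σ | F t]) ω ≤ (P[snellReward I o t τ | F t]) ω}
        with hB
      have hBm : MeasurableSet[F t] B :=
        @measurableSet_le _ _ _ _ _ (F t) _ _ _ _ _ stronglyMeasurable_condExp.measurable
          stronglyMeasurable_condExp.measurable
      set ρ : Ω → Time T := B.piecewise τ σ with hρ
      have hρs : IsStopping F ρ := by
        refine isStopping_iff.2 fun s => ?_
        -- Both times are at least `t`, so `{ρ ≤ s}` is empty for `s < t`; for `s ≥ t` the event `B`
        -- is already known.
        by_cases hts : t ≤ s
        · have : {ω | ρ ω ≤ s} = B ∩ {ω | τ ω ≤ s} ∪ Bᶜ ∩ {ω | σ ω ≤ s} := by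
            ext ω
            by_cases hω : ω ∈ B <;> simp [hρ, hω]
          rw [this]
          exact ((F.mono hts _ hBm).inter (isStopping_iff.1 hτ s)).union
            ((F.mono hts _ hBm).compl.inter (isStopping_iff.1 hσ s))
        · have : {ω | ρ ω ≤ s} = ∅ := by
            ext ω
            simp only [Set.mem_ofPred_eq, Set.mem_empty_iff_false, iff_false]
            intro hle
            refine hts (le_trans ?_ hle)
            by_cases hω : ω ∈ B <;> simp [hρ, hω, htτ, htσ]
          rw [this]
          exact @MeasurableSet.empty _ (F s)
      have htρ : ∀ ω, t ≤ ρ ω := fun ω => by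
        by_cases hω : ω ∈ B <;> simp [hρ, hω, htτ, htσ]
      have hi := h.integrable_reward t hρs.measurable
      have h1 := condExp_indicator hi hBm (μ := P) (m := F t)
      have h2 := condExp_indicator (h.integrable_reward t hτ.measurable) hBm (μ := P) (m := F t)
      have h3 := condExp_indicator hi hBm.compl (μ := P) (m := F t)
      have h4 := condExp_indicator (h.integrable_reward t hσ.measurable) hBm.compl (μ := P)
        (m := F t)
      have e1 : B.indicator (snellReward I o t ρ) = B.indicator (snellReward I o t τ) := by
        ext ω
        by_cases hω : ω ∈ B <;> simp [snellReward, hρ, hω]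
      have e2 : Bᶜ.indicator (snellReward I o t ρ) = Bᶜ.indicator (snellReward I o t σ) := by
        ext ω
        by_cases hω : ω ∈ B <;> simp [snellReward, hρ, hω]
      rw [e1] at h1
      rw [e2] at h3
      have key : ∀ᵐ ω ∂P, (P[snellReward I o t ρ | F t]) ω =
          max ((P[snellReward I o t τ | F t]) ω) ((P[snellReward I o t σ | F t]) ω) := by
        filter_upwards [h1, h2, h3, h4] with ω h1 h2 h3 h4
        by_cases hω : ω ∈ B
        · have := h1.symm.trans h2
          rw [Set.indicator_of_mem hω, Set.indicator_of_mem hω] at this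
          rw [this]
          exact (max_eq_left hω).symm
        · have hω' : ω ∈ Bᶜ := hω
          have := h3.symm.trans h4
          rw [Set.indicator_of_mem hω', Set.indicator_of_mem hω'] at this
          rw [this]
          exact (max_eq_right (not_le.1 hω).le).symm
      refine ⟨_, ⟨ρ, hρs, htρ, rfl⟩, ?_, ?_⟩
      · filter_upwards [key] with ω hω
        rw [hω]
        exact le_max_left _ _
      · filter_upwards [key] with ω hω
        rw [hω]
        exact le_max_right _ _) hε
  exact ⟨τ, hτ, htτ, by rwa [integral_condExp (F.le t)] at hle⟩

/-- A nearly optimal stopping time from `t` on also competes at time `s`, where its reward only has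
the extra term `I t - I s`. -/
theorem supermartingale_le (h : IsSnellEnvelope F P y o I W) {s t : Time T} (hst : s ≤ t)
    {A : Set Ω} (hA : MeasurableSet[F s] A) :
    ∫ ω in A, ((y t ω + I t ω) - (y s ω + I s ω)) ∂P ≤ 0 := by
  refine le_of_forall_pos_le_add fun ε hε => ?_
  obtain ⟨τ, hτ, htτ, hle⟩ := h.exists_integral_le t hε
  have hAt : MeasurableSet[F t] A := F.mono hst _ hA
  have hAm : MeasurableSet A := F.le t _ hAt
  have hy := fun t => h.integrable_value (τ := fun _ => t) measurable_const
  have hI := fun t => h.integrable_running (τ := fun _ => t) measurable_const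
  have hr := fun t => h.integrable_reward t hτ.measurable
  -- Near optimality on the whole space localizes to `A`, because on `Aᶜ` the reward is at most the
  -- value.
  have h1 : ∫ ω in A, y t ω ∂P ≤ ∫ ω in A, snellReward I o t τ ω ∂P + ε := by
    have := h.setIntegral_reward_le hτ htτ hAt.compl
    rw [← integral_add_compl hAm (hy t), ← integral_add_compl hAm (hr t)] at hle
    linarith
  have h2 := h.setIntegral_reward_le hτ (fun ω => hst.trans (htτ ω)) hA
  have h3 : ∫ ω in A, snellReward I o s τ ω ∂P =
      ∫ ω in A, (I t ω - I s ω) ∂P + ∫ ω in A, snellReward I o t τ ω ∂P := by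
    refine (integral_congr_ae (ae_of_all _ fun ω => ?_)).trans
      (integral_add ((hI t).sub (hI s)).integrableOn (hr t).integrableOn)
    simp only [snellReward]
    ring
  have h4 : ∫ ω in A, ((y t ω + I t ω) - (y s ω + I s ω)) ∂P =
      ∫ ω in A, y t ω ∂P - ∫ ω in A, y s ω ∂P + ∫ ω in A, (I t ω - I s ω) ∂P := by
    rw [← integral_sub (hy t).integrableOn (hy s).integrableOn]
    refine (integral_congr_ae (ae_of_all _ fun ω => ?_)).trans
      (integral_add ((hy t).sub (hy s)).integrableOn ((hI t).sub (hI s)).integrableOn)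
    ring
  rw [h4]
  linarith

/-- Stopping at once gives the bound for each `t < ⊤`; continuity makes it simultaneous in `t`. At
`⊤` the reward contains no obstacle, so the bound there comes from density of the earlier times,
which needs `0 < T`. -/
theorem obstacle_le_value (h : IsSnellEnvelope F P y o I W) (hT : 0 < T) :
    ∀ᵐ ω ∂P, ∀ t, o t ω ≤ y t ω := by
  classical
  have h1 : ∀ t : Time T, t < ⊤ → o t ≤ᵐ[P] y t := fun t ht => by
    have h2 := h.condExp_reward_le (isStopping_const t) fun _ => le_rfl
    have h3 : snellReward I o t (fun _ => t) = o t := by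
      ext ω
      simp [snellReward, ht]
    rw [h3, condExp_of_stronglyMeasurable (F.le t) (h.adapted_obstacle t).stronglyMeasurable
      (integrable_eval h.measurable_obstacle h.continuous_obstacle h.integrable_bound
        h.obstacle_le measurable_const)] at h2
    exact h2
  obtain ⟨D, hDc, hD⟩ := TopologicalSpace.exists_countable_dense (Time T)
  have h2 : ∀ᵐ ω ∂P, ∀ t ∈ D, t < ⊤ → o t ω ≤ y t ω := by
    rw [ae_ball_iff hDc]
    intro t _
    by_cases ht : t < ⊤
    · exact (h1 t ht).mono fun ω hω _ => hω
    · exact ae_of_all _ fun ω h => absurd h ht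
  filter_upwards [h2] with ω hω
  have hclosed : IsClosed {t | o t ω ≤ y t ω} :=
    isClosed_le (h.continuous_obstacle ω) (h.continuous_value ω)
  have hbt : (⊥ : Time T) < ⊤ := by
    rw [← Subtype.coe_lt_coe]
    exact hT
  have hIio : closure (Set.Iio (⊤ : Time T)) = Set.univ := by
    rw [closure_Iio' ⟨⊥, hbt⟩]
    exact Set.Iic_top
  have hdense : Dense (Set.Iio (⊤ : Time T) ∩ D) :=
    Dense.inter_of_isOpen_left (dense_iff_closure_eq.2 hIio) hD isOpen_Iio
  intro t
  have : closure (Set.Iio (⊤ : Time T) ∩ D) ⊆ {t | o t ω ≤ y t ω} :=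
    hclosed.closure_subset_iff.2 fun s hs => hω s hs.2 hs.1
  exact this (hdense t)

theorem continuous_sum (h : IsSnellEnvelope F P y o I W) (ω : Ω) :
    Continuous fun t => y t ω + I t ω :=
  (h.continuous_value ω).add (h.continuous_running ω)

theorem measurable_sum (h : IsSnellEnvelope F P y o I W) (t : Time T) :
    Measurable fun ω => y t ω + I t ω :=
  (h.measurable_value t).add (h.measurable_running t)

theorem sum_le (h : IsSnellEnvelope F P y o I W) (t : Time T) (ω : Ω) :
    |y t ω + I t ω| ≤ 2 * W ω := by
  have := abs_add_le (y t ω) (I t ω)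
  linarith [h.value_le t ω, h.running_le t ω]

theorem integrable_sum (h : IsSnellEnvelope F P y o I W) {τ : Ω → Time T} (hτ : Measurable τ) :
    Integrable (fun ω => y (τ ω) ω + I (τ ω) ω) P :=
  (h.integrable_value hτ).add (h.integrable_running hτ)

theorem stopped_le (h : IsSnellEnvelope F P y o I W) (hT : 0 < T) {σ τ : Ω → Time T}
    (hσ : IsStopping F σ) (hτ : IsStopping F τ)
    (hστ : ∀ ω, σ ω ≤ τ ω) {A : Set Ω}
    (hA : MeasurableSet[IsStoppingTime.measurableSpace hσ] A) :
    ∫ ω in A, ((y (τ ω) ω + I (τ ω) ω) - (y (σ ω) ω + I (σ ω) ω)) ∂P ≤ 0 :=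
  setIntegral_stopped_le (Z := fun t ω => y t ω + I t ω) hT h.measurable_sum h.continuous_sum
    (h.integrable_bound.const_mul 2) h.sum_le (fun _ _ hst _ hA => h.supermartingale_le hst hA)
    hσ hτ hστ hA

theorem integral_stopped_le (h : IsSnellEnvelope F P y o I W) (hT : 0 < T) {σ τ : Ω → Time T}
    (hσ : IsStopping F σ) (hτ : IsStopping F τ)
    (hστ : ∀ ω, σ ω ≤ τ ω) :
    ∫ ω, (y (τ ω) ω + I (τ ω) ω) ∂P ≤ ∫ ω, (y (σ ω) ω + I (σ ω) ω) ∂P := by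
  have h1 := h.stopped_le hT hσ hτ hστ (A := Set.univ)
    (@MeasurableSet.univ _ (IsStoppingTime.measurableSpace hσ))
  rw [Measure.restrict_univ,
    integral_sub (h.integrable_sum hτ.measurable) (h.integrable_sum hσ.measurable)] at h1
  linarith

theorem isStopping_firstHit (h : IsSnellEnvelope F P y o I W) {σ : Ω → Time T}
    (hσ : IsStopping F σ) :
    IsStopping F fun ω => firstHit (fun t ω => y t ω - o t ω) (σ ω) ω :=
  OptimalSwitching.isStopping_firstHit
    (fun ω => (h.continuous_value ω).sub (h.continuous_obstacle ω))
    (fun t => (h.adapted_value t).sub (h.adapted_obstacle t)) hσ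

/-- For nearly optimal `τ n`, the gap `d n` between value and reward at `τ n` is nonnegative with
mean tending to `0`, hence tends to `0` almost surely along a subsequence. Since `y - o` is bounded
below by a positive constant on compact intervals before `ρ`, this forces `min (τ n) ρ → ρ`. The
supermartingale property between `min (τ n) ρ` and `τ n` then gives the bound in the limit. -/
theorem integral_firstHit_ge (h : IsSnellEnvelope F P y o I W) (hT : 0 < T) (t : Time T) :
    ∫ ω, (y t ω + I t ω) ∂P ≤
      ∫ ω, (y (firstHit (fun t ω => y t ω - o t ω) t ω) ω +
        I (firstHit (fun t ω => y t ω - o t ω) t ω) ω) ∂P := by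
  classical
  set ρ : Ω → Time T := firstHit (fun t ω => y t ω - o t ω) t with hρdef
  have hρ : IsStopping F ρ := h.isStopping_firstHit (isStopping_const t)
  choose τ hτ htτ hle using fun n : ℕ =>
    h.exists_integral_le t (ε := 1 / ((n : ℝ) + 1)) (by positivity)
  have hε : Tendsto (fun n : ℕ => 1 / ((n : ℝ) + 1)) atTop (𝓝 0) :=
    tendsto_one_div_add_atTop_nhds_zero_nat
  have hys := h.integrable_value (τ := fun _ => t) measurable_const
  have hIs := h.integrable_running (τ := fun _ => t) measurable_const
  have hr := fun n => h.integrable_reward t (hτ n).measurable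
  set d : ℕ → Ω → ℝ := fun n ω =>
    y (τ n ω) ω - if τ n ω < ⊤ then o (τ n ω) ω else 0 with hd
  have hdi : ∀ n, Integrable (d n) P := fun n =>
    (h.integrable_value (hτ n).measurable).sub (h.integrable_terminal (hτ n).measurable)
  have hd0 : ∀ n, 0 ≤ᵐ[P] d n := fun n => by
    filter_upwards [h.obstacle_le_value hT, h.terminal] with ω h1 h2
    simp only [hd, Pi.zero_apply]
    split_ifs with hlt
    · exact sub_nonneg.2 (h1 _)
    · rw [not_lt_top_iff.1 hlt, h2]
      simp
  have hdsum : ∀ n, ∫ ω, (y (τ n ω) ω + I (τ n ω) ω) ∂P =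
      ∫ ω, d n ω ∂P + ∫ ω, snellReward I o t (τ n) ω ∂P + ∫ ω, I t ω ∂P := fun n => by
    rw [← integral_add (hdi n) (hr n)]
    refine (integral_congr_ae (ae_of_all _ fun ω => ?_)).trans
      (integral_add ((hdi n).add (hr n)) hIs)
    simp only [snellReward, hd]
    ring
  have hyI : ∫ ω, (y t ω + I t ω) ∂P = ∫ ω, y t ω ∂P + ∫ ω, I t ω ∂P := integral_add hys hIs
  have hdle : ∀ n, ∫ ω, d n ω ∂P ≤ 1 / ((n : ℝ) + 1) := fun n => by
    have h1 := h.integral_stopped_le hT (isStopping_const t) (hτ n) (htτ n)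
    rw [hdsum n, hyI] at h1
    linarith [hle n]
  have hdtend : Tendsto (fun n => ∫ ω, d n ω ∂P) atTop (𝓝 0) :=
    tendsto_of_tendsto_of_tendsto_of_le_of_le tendsto_const_nhds hε
      (fun n => integral_nonneg_of_ae (hd0 n)) hdle
  have hmeas : TendstoInMeasure P d atTop 0 := by
    refine tendstoInMeasure_of_tendsto_eLpNorm one_ne_zero (fun n => (hdi n).1)
      aestronglyMeasurable_zero ?_
    have h1 : ∀ n, eLpNorm (d n - 0) 1 P = ENNReal.ofReal (∫ ω, d n ω ∂P) := fun n => by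
      rw [sub_zero, eLpNorm_one_eq_lintegral_enorm,
        ofReal_integral_eq_lintegral_ofReal (hdi n) (hd0 n)]
      refine lintegral_congr_ae ((hd0 n).mono fun ω hω => ?_)
      exact Real.enorm_of_nonneg hω
    simp only [h1]
    have := (ENNReal.continuous_ofReal.tendsto 0).comp hdtend
    rwa [ENNReal.ofReal_zero] at this
  obtain ⟨ns, hns, hae⟩ := hmeas.exists_seq_tendsto_ae
  have hlim : ∀ᵐ ω ∂P, Tendsto (fun n => min (τ (ns n) ω) (ρ ω)) atTop (𝓝 (ρ ω)) := by
    filter_upwards [hae, h.obstacle_le_value hT] with ω h1 h2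
    refine tendsto_order.2 ⟨fun a ha => ?_, fun b hb => Eventually.of_forall fun n =>
      (min_le_right _ _).trans_lt hb⟩
    by_cases hta : t ≤ a
    · have hcont : Continuous fun s => y s ω - o s ω :=
        (h.continuous_value ω).sub (h.continuous_obstacle ω)
      obtain ⟨r, hr, hmin⟩ := isCompact_Icc.exists_isMinOn (Set.nonempty_Icc.2 hta)
        hcont.continuousOn
      have hpos : 0 < y r ω - o r ω := lt_of_le_of_ne (sub_nonneg.2 (h2 r))
        (ne_zero_of_lt_firstHit (h := fun t ω => y t ω - o t ω) hr.1 (hr.2.trans_lt ha)).symm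
      filter_upwards [h1.eventually_lt_const (show (0 : Ω → ℝ) ω < _ from hpos)] with n hn
      refine lt_min (not_le.1 fun hle => ?_) ha
      have hlt : τ (ns n) ω < ⊤ := (hle.trans_lt ha).trans_le le_top
      simp only [hd, if_pos hlt] at hn
      exact absurd (hmin (show τ (ns n) ω ∈ Set.Icc t a from ⟨htτ _ ω, hle⟩)) (not_le.2 hn)
    · exact Eventually.of_forall fun n =>
        lt_min ((not_le.1 hta).trans_le (htτ _ ω)) ha
  have hlim2 : Tendsto (fun n =>
        ∫ ω, (y (min (τ (ns n) ω) (ρ ω)) ω + I (min (τ (ns n) ω) (ρ ω)) ω) ∂P)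
      atTop (𝓝 (∫ ω, (y (ρ ω) ω + I (ρ ω) ω) ∂P)) := by
    have := tendsto_setIntegral_eval (P := P) (Z := fun t ω => y t ω + I t ω) (A := Set.univ)
      h.measurable_sum h.continuous_sum (h.integrable_bound.const_mul 2) h.sum_le
      (fun n => ((hτ (ns n)).min hρ).measurable) (by rwa [Measure.restrict_univ])
    simpa only [Measure.restrict_univ] using this
  have hε2 : Tendsto (fun n => ∫ ω, (y t ω + I t ω) ∂P - 1 / (((ns n : ℕ) : ℝ) + 1)) atTop
      (𝓝 (∫ ω, (y t ω + I t ω) ∂P - 0)) :=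
    tendsto_const_nhds.sub (hε.comp hns.tendsto_atTop)
  rw [sub_zero] at hε2
  refine le_of_tendsto_of_tendsto' hε2 hlim2 fun n => ?_
  have h1 := h.integral_stopped_le hT ((hτ (ns n)).min hρ) (hτ (ns n)) fun ω => min_le_left _ _
  have h2 := integral_nonneg_of_ae (hd0 (ns n))
  have h3 := hdsum (ns n)
  have h4 := hle (ns n)
  linarith

/-- The Snell envelope is a martingale up to the first time at which it meets its obstacle. -/
theorem stopped_eq (h : IsSnellEnvelope F P y o I W) (hT : 0 < T) {σ : Ω → Time T}
    (hσ : IsStopping F σ) {A : Set Ω}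
    (hA : MeasurableSet[IsStoppingTime.measurableSpace hσ] A) :
    ∫ ω in A, ((y (firstHit (fun t ω => y t ω - o t ω) (σ ω) ω) ω +
        I (firstHit (fun t ω => y t ω - o t ω) (σ ω) ω) ω) - (y (σ ω) ω + I (σ ω) ω)) ∂P = 0 := by
  refine setIntegral_firstHit_stopped (Z := fun t ω => y t ω + I t ω)
    (h := fun t ω => y t ω - o t ω) hT h.measurable_sum
    h.continuous_sum (h.integrable_bound.const_mul 2) h.sum_le
    (fun ω => (h.continuous_value ω).sub (h.continuous_obstacle ω))
    (fun t => (h.adapted_value t).sub (h.adapted_obstacle t)) (fun t A hA => ?_) hσ hA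
  have hρ := h.isStopping_firstHit (isStopping_const t)
  have hle := fun {A : Set Ω} (hA : MeasurableSet[F t] A) =>
    h.stopped_le hT (isStopping_const t) hρ (fun ω => le_firstHit _ _) (A := A)
      (by rwa [IsStoppingTime.measurableSpace_const])
  have h1 := h.integral_firstHit_ge hT t
  have i1 := h.integrable_sum hρ.measurable
  have i2 := h.integrable_sum (τ := fun _ => t) measurable_const
  have h2 := integral_add_compl (F.le t _ hA) (i1.sub i2)
  have h3 := integral_sub i1 i2
  -- The increments over `A` and `Aᶜ` are both nonpositive, while their sum is nonnegative by `h1`.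
  have h4 := hle hA
  have h5 := hle hA.compl
  simp only [Pi.sub_apply] at h2
  refine le_antisymm h4 ?_
  linarith

end IsSnellEnvelope

end SnellEnvelope

end OptimalSwitching

namespace OptimalSwitching

/-! ### Square integrable bounds and running integrals. -/

section Bounds

open Filter Topology

set_option linter.unusedSectionVars false

variable {T : ℝ} {Ω : Type*} {mΩ : MeasurableSpace Ω} {F : Filtration (Time T) mΩ}
  {P : Measure Ω}

instance isFiniteMeasure_leb (T : ℝ) : IsFiniteMeasure (leb T) := by
  refine ⟨?_⟩
  rw [leb, (MeasurableEmbedding.subtype_coe measurableSet_Icc).comap_apply, Set.image_univ,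
    Subtype.range_coe, Real.volume_Icc]
  exact ENNReal.ofReal_lt_top

instance nullSingletonClass_leb (T : ℝ) : NullSingletonClass (leb T) := by
  refine ⟨fun s => ?_⟩
  rw [leb, (MeasurableEmbedding.subtype_coe measurableSet_Icc).comap_apply, Set.image_singleton,
    Real.volume_singleton]

theorem memLp_two_of_lintegral_sq {f : Ω → ℝ} (hf : Measurable f)
    (h : ∫⁻ ω, ‖f ω‖ₑ ^ 2 ∂P < ∞) : MemLp f 2 P := by
  rw [memLp_two_iff_integrable_sq hf.aestronglyMeasurable]
  refine ⟨(hf.pow_const 2).aestronglyMeasurable, ?_⟩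
  simpa only [HasFiniteIntegral, enorm_pow] using h

theorem MemS2.measurable {w : Time T → Ω → ℝ} (hw : MemS2 F P w) (t : Time T) :
    Measurable[F t] (w t) := (hw.1.stronglyAdapted t).measurable

/-- A process of class `𝒮²` is dominated by a square integrable random variable. -/
theorem MemS2.exists_bound [Fact (0 ≤ T)] {w : Time T → Ω → ℝ} (hw : MemS2 F P w) :
    ∃ V : Ω → ℝ, MemLp V 2 P ∧ ∀ t ω, |w t ω| ≤ V ω := by
  have hm : ∀ t, Measurable (w t) := fun t => (hw.measurable t).mono (F.le t) le_rfl
  -- The supremum is taken over a countable dense set to be measurable; continuity extends the bound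
  -- to all times.
  set D := TopologicalSpace.denseSeq (Time T) with hD
  set S : Ω → ℝ≥0∞ := fun ω => ⨆ n, ‖w (D n) ω‖ₑ with hS
  have hSm : Measurable S := Measurable.iSup fun n => (hm _).enorm
  have hfin : ∀ ω, S ω ≠ ∞ := fun ω => by
    obtain ⟨C, hC⟩ := isCompact_univ.exists_bound_of_continuousOn (hw.2.1 ω).continuousOn
    refine ne_top_of_le_ne_top (b := ENNReal.ofReal C) ENNReal.ofReal_ne_top
      (iSup_le fun n => ?_)
    rw [← ofReal_norm]
    exact ENNReal.ofReal_le_ofReal (hC _ (Set.mem_univ _))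
  refine ⟨fun ω => (S ω).toReal, memLp_two_of_lintegral_sq hSm.ennreal_toReal ?_, fun t ω => ?_⟩
  · refine lt_of_le_of_lt (lintegral_mono fun ω => ?_) hw.2.2
    rw [← ofReal_norm, Real.norm_of_nonneg ENNReal.toReal_nonneg,
      ENNReal.ofReal_toReal (hfin ω), hS, ENNReal.iSup_pow]
    exact iSup_le fun n => le_iSup (fun t => ‖w t ω‖ₑ ^ 2) (D n)
  · have hclosed : IsClosed {t | |w t ω| ≤ (S ω).toReal} :=
      isClosed_le (hw.2.1 ω).abs continuous_const
    have hsub : Set.range D ⊆ {t | |w t ω| ≤ (S ω).toReal} := by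
      rintro _ ⟨n, rfl⟩
      have h1 : ‖w (D n) ω‖ₑ ≤ S ω := le_iSup (fun n => ‖w (D n) ω‖ₑ) n
      have h2 := ENNReal.toReal_mono (hfin ω) h1
      simpa using h2
    exact hclosed.closure_subset_iff.2 hsub (TopologicalSpace.denseRange_denseSeq _ t)

variable [Fact (0 ≤ T)] {w : Time T → Ω → ℝ}

/-- The running integral `∫_0^t w s ds`. -/
noncomputable def running (w : Time T → Ω → ℝ) (t : Time T) (ω : Ω) : ℝ :=
  ∫ s in Set.Ioc ⊥ t, w s ω ∂leb T

theorem integrable_path {f : Time T → ℝ} (hf : Continuous f) : Integrable f (leb T) :=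
  hf.integrable_of_hasCompactSupport (HasCompactSupport.of_compactSpace f)

theorem running_sub (hc : ∀ ω, Continuous fun t => w t ω) {s t : Time T} (hst : s ≤ t) (ω : Ω) :
    running w t ω - running w s ω = ∫ r in Set.Ioc s t, w r ω ∂leb T := by
  have hi := integrable_path (hc ω)
  rw [running, running, ← Set.Ioc_union_Ioc_eq_Ioc bot_le hst,
    setIntegral_union (Set.Ioc_disjoint_Ioc_of_le le_rfl) measurableSet_Ioc hi.integrableOn
      hi.integrableOn]
  ring

/-- Dominated convergence: the indicators of `(⊥, r]` converge to that of `(⊥, t]` off the null set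
`{t}`. -/
theorem continuous_running (hc : ∀ ω, Continuous fun t => w t ω) (ω : Ω) :
    Continuous fun t => running w t ω := by
  have hi := integrable_path (hc ω)
  refine continuous_iff_continuousAt.2 fun t => ?_
  have heq : (fun t => running w t ω) =
      fun t => ∫ s, (Set.Ioc ⊥ t).indicator (fun s => w s ω) s ∂leb T := by
    ext t
    rw [integral_indicator measurableSet_Ioc, running]
  rw [heq]
  refine tendsto_integral_filter_of_dominated_convergence (fun s => |w s ω|)
    (Eventually.of_forall fun t => (hi.indicator measurableSet_Ioc).1)
    (Eventually.of_forall fun t => ae_of_all _ fun s => ?_) hi.abs ?_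
  · rw [← Real.norm_eq_abs]
    exact norm_indicator_le_norm_self _ _
  · have hne : ∀ᵐ s ∂leb T, s ≠ t := by
      rw [ae_iff]
      simp
    filter_upwards [hne] with s hs
    refine tendsto_const_nhds.congr' ?_
    rcases lt_or_gt_of_ne hs with hlt | hlt
    · filter_upwards [lt_mem_nhds hlt] with r hr
      by_cases hb : ⊥ < s
      · rw [Set.indicator_of_mem (show s ∈ Set.Ioc ⊥ t from ⟨hb, hlt.le⟩),
          Set.indicator_of_mem (show s ∈ Set.Ioc ⊥ r from ⟨hb, hr.le⟩)]
      · rw [Set.indicator_of_notMem (fun h : s ∈ Set.Ioc ⊥ t => hb h.1),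
          Set.indicator_of_notMem (fun h : s ∈ Set.Ioc ⊥ r => hb h.1)]
    · filter_upwards [gt_mem_nhds hlt] with r hr
      rw [Set.indicator_of_notMem (fun h : s ∈ Set.Ioc ⊥ t => h.2.not_gt hlt),
        Set.indicator_of_notMem (fun h : s ∈ Set.Ioc ⊥ r => h.2.not_gt hr)]

theorem measurable_running {m : MeasurableSpace Ω} {t : Time T}
    (hc : ∀ ω, Continuous fun t => w t ω) (hm : ∀ s ≤ t, Measurable[m] (w s)) :
    Measurable[m] (running w t) := by
  -- Freezing the process at `t` makes it jointly measurable using only the values up to `t`, and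
  -- does not change the integral.
  have h1 : Measurable (Function.uncurry fun (s : Time T) ω => w (min s t) ω) :=
    measurable_uncurry_of_continuous_of_measurable
      (fun ω => (hc ω).comp (continuous_id.min continuous_const))
      fun s => hm _ (min_le_right _ _)
  have h2 := (h1.stronglyMeasurable.integral_prod_left
    (μ := (leb T).restrict (Set.Ioc ⊥ t))).measurable
  convert h2 using 1
  ext ω
  exact setIntegral_congr_fun measurableSet_Ioc fun s hs => by simp only [min_eq_left hs.2]

theorem running_le (hc : ∀ ω, Continuous fun t => w t ω) (t : Time T) (ω : Ω) :
    |running w t ω| ≤ ∫ s, |w s ω| ∂leb T := by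
  have hi := integrable_path (hc ω)
  refine (abs_integral_le_integral_abs).trans ?_
  exact setIntegral_le_integral hi.abs (ae_of_all _ fun s => abs_nonneg _)

/-- Cauchy–Schwarz, in the form that the variance of `|f|` about its average `U / T` is nonnegative.
-/
theorem sq_integral_abs_le {f : Time T → ℝ} (hf : Continuous f) (hT : 0 < T) :
    (∫ s, |f s| ∂leb T) ^ 2 ≤ T * ∫ s, f s ^ 2 ∂leb T := by
  have hmass : (leb T).real Set.univ = T := by
    rw [Measure.real, leb, (MeasurableEmbedding.subtype_coe measurableSet_Icc).comap_apply,
      Set.image_univ, Subtype.range_coe, Real.volume_Icc, sub_zero, ENNReal.toReal_ofReal hT.le]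
  set U := ∫ s, |f s| ∂leb T with hU
  have i1 : Integrable (fun s => f s ^ 2) (leb T) := integrable_path (hf.pow 2)
  have i2 := integrable_path hf.abs
  have h1 : 0 ≤ ∫ s, (f s ^ 2 - 2 * (U / T) * |f s| + (U / T) ^ 2) ∂leb T := by
    refine integral_nonneg fun s => ?_
    simp only [Pi.zero_apply]
    nlinarith [sq_nonneg (|f s| - U / T), sq_abs (f s)]
  rw [integral_add (f := fun s => f s ^ 2 - 2 * (U / T) * |f s|) (i1.sub (i2.const_mul _))
      (integrable_const _),
    integral_sub i1 (i2.const_mul _), integral_const_mul, integral_const, hmass, ← hU,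
    smul_eq_mul] at h1
  have h2 : 2 * (U / T) * U - T * (U / T) ^ 2 = U ^ 2 / T := by
    field_simp
    ring
  have h3 : U ^ 2 / T ≤ ∫ s, f s ^ 2 ∂leb T := by linarith
  rwa [div_le_iff₀ hT, mul_comm] at h3

theorem MemM2.memLp_integral_abs (hT : 0 < T) (hw : MemM2 F P w)
    (hc : ∀ ω, Continuous fun t => w t ω) : MemLp (fun ω => ∫ s, |w s ω| ∂leb T) 2 P := by
  have hm : ∀ t, Measurable (w t) := fun t =>
    ((hw.1.stronglyAdapted t).mono (F.le t)).measurable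
  have h1 : Measurable (Function.uncurry fun s ω => |w s ω|) :=
    (measurable_uncurry_of_continuous_of_measurable hc hm).abs
  refine memLp_two_of_lintegral_sq
    (h1.stronglyMeasurable.integral_prod_left (μ := leb T)).measurable ?_
  have h2 : ∀ ω, ‖∫ s, |w s ω| ∂leb T‖ₑ ^ 2 ≤
      ENNReal.ofReal T * ∫⁻ s, ‖w s ω‖ₑ ^ 2 ∂leb T := fun ω => by
    have h3 : ∫⁻ s, ‖w s ω‖ₑ ^ 2 ∂leb T = ENNReal.ofReal (∫ s, w s ω ^ 2 ∂leb T) := by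
      have hi : Integrable (fun s => w s ω ^ 2) (leb T) := integrable_path ((hc ω).pow 2)
      rw [ofReal_integral_eq_lintegral_ofReal hi (ae_of_all _ fun s => sq_nonneg _)]
      refine lintegral_congr fun s => ?_
      rw [← enorm_pow, Real.enorm_of_nonneg (sq_nonneg _)]
    rw [h3, ← ENNReal.ofReal_mul hT.le, ← enorm_pow, Real.enorm_of_nonneg (sq_nonneg _)]
    exact ENNReal.ofReal_le_ofReal (sq_integral_abs_le (hc ω) hT)
  refine (lintegral_mono h2).trans_lt ?_
  rw [lintegral_const_mul' _ _ ENNReal.ofReal_ne_top]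
  exact ENNReal.mul_lt_top ENNReal.ofReal_lt_top hw.2

end Bounds

/-! ### The obstacles, and the system as a family of Snell envelopes. -/

section Obstacle

open Filter Topology

set_option linter.unusedSectionVars false

variable {T : ℝ} [Fact (0 ≤ T)] {Ω : Type*} {mΩ : MeasurableSpace Ω} {k m : ℕ}
  {F : Filtration (Time T) mΩ} {P : Measure Ω}
  {ψ : Fin m → Time T → EuclideanSpace ℝ (Fin k) → ℝ}
  {g : Fin m → Fin m → Time T → EuclideanSpace ℝ (Fin k) → ℝ}
  {X : Time T → Ω → EuclideanSpace ℝ (Fin k)} {Y : Fin m → Time T → Ω → ℝ}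

theorem nonempty_ne (hm : 2 ≤ m) (i : Fin m) : Nonempty {j : Fin m // j ≠ i} := by
  have : Nontrivial (Fin m) := Fin.nontrivial_iff_two_le.2 hm
  obtain ⟨j, hj⟩ := exists_ne i
  exact ⟨⟨j, hj⟩⟩

theorem le_obstacle {i j : Fin m} (hij : j ≠ i) (s : Time T) (ω : Ω) :
    -g i j s (X s ω) + Y j s ω ≤ obstacle g X Y i s ω :=
  le_ciSup (f := fun j : {j : Fin m // j ≠ i} => -g i j s (X s ω) + Y j s ω)
    (Set.finite_range _).bddAbove ⟨j, hij⟩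

theorem exists_eq_obstacle (hm : 2 ≤ m) (i : Fin m) (s : Time T) (ω : Ω) :
    ∃ j, j ≠ i ∧ obstacle g X Y i s ω = -g i j s (X s ω) + Y j s ω := by
  have := nonempty_ne hm i
  obtain ⟨⟨j, hj⟩, h⟩ := exists_eq_ciSup_of_finite
    (f := fun j : {j : Fin m // j ≠ i} => -g i j s (X s ω) + Y j s ω)
  exact ⟨j, hj, h.symm⟩

theorem obstacle_eq_sup' (hm : 2 ≤ m) (i : Fin m) (s : Time T) (ω : Ω) :
    obstacle g X Y i s ω = (Finset.univ (α := {j : Fin m // j ≠ i})).sup'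
      (@Finset.univ_nonempty _ _ (nonempty_ne hm i))
      fun j => -g i j s (X s ω) + Y j s ω := by
  have := nonempty_ne hm i
  exact (Finset.sup'_univ_eq_ciSup _).symm

theorem continuous_obstacle (hm : 2 ≤ m) (hg : ∀ i j ω, Continuous fun t => g i j t (X t ω))
    (hY : ∀ i ω, Continuous fun t => Y i t ω) (i : Fin m) (ω : Ω) :
    Continuous fun t => obstacle g X Y i t ω := by
  simp only [obstacle_eq_sup' hm]
  exact Continuous.finset_sup'_apply _ fun j _ => (hg i j ω).neg.add (hY j ω)

theorem measurable_obstacle {m' : MeasurableSpace Ω} {i : Fin m} {τ : Ω → Time T}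
    (hg : ∀ j, Measurable[m'] fun ω => g i j (τ ω) (X (τ ω) ω))
    (hY : ∀ j, Measurable[m'] fun ω => Y j (τ ω) ω) :
    Measurable[m'] fun ω => obstacle g X Y i (τ ω) ω :=
  Measurable.iSup fun j : {j : Fin m // j ≠ i} => (hg j).neg.add (hY j)

theorem stoppingReward_eq (hψ : ∀ i ω, Continuous fun t => ψ i t (X t ω)) {i : Fin m}
    {t : Time T} {τ : Ω → Time T} (htτ : ∀ ω, t ≤ τ ω) :
    stoppingReward ψ g X Y i t τ =
      snellReward (running fun t ω => ψ i t (X t ω)) (obstacle g X Y i) t τ := by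
  ext ω
  rw [stoppingReward, snellReward, running_sub (hψ i) (htτ ω)]

/-- One `W` serves all modes and all three processes: the sum of the bounds of every `Y^i`, every
`g_{ij}` and every running integral. -/
theorem isSnellEnvelope_of_isSnellSystem (hT : 0 < T) (hm : 2 ≤ m)
    (hψc : ∀ i ω, Continuous fun t => ψ i t (X t ω))
    (hψ : ∀ i, MemM2 F P fun t ω => ψ i t (X t ω))
    (hg : ∀ i j, MemS2 F P fun t ω => g i j t (X t ω)) (hY2 : ∀ i, MemS2 F P (Y i))
    (hY : IsSnellSystem ψ g X Y F P) :
    ∃ W : Ω → ℝ, ∀ i, IsSnellEnvelope F P (Y i) (obstacle g X Y i)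
      (running fun t ω => ψ i t (X t ω)) W := by
  choose VY hVY hVY' using fun i => (hY2 i).exists_bound
  choose Vg hVg hVg' using fun i j => (hg i j).exists_bound
  set Vψ : Fin m → Ω → ℝ := fun i ω => ∫ s, |ψ i s (X s ω)| ∂leb T
  have hVψ : ∀ i, MemLp (Vψ i) 2 P := fun i => (hψ i).memLp_integral_abs hT (hψc i)
  have hVψ' : ∀ i t ω, |running (fun t ω => ψ i t (X t ω)) t ω| ≤ Vψ i ω := fun i t ω =>
    running_le (hψc i) t ω
  have h0Y : ∀ i ω, 0 ≤ VY i ω := fun i ω => (abs_nonneg _).trans (hVY' i ⊥ ω)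
  have h0g : ∀ i j ω, 0 ≤ Vg i j ω := fun i j ω => (abs_nonneg _).trans (hVg' i j ⊥ ω)
  have h0ψ : ∀ i ω, 0 ≤ Vψ i ω := fun i ω => (abs_nonneg _).trans (hVψ' i ⊥ ω)
  have hsY : ∀ i ω, VY i ω ≤ ∑ i, VY i ω := fun i ω =>
    Finset.single_le_sum (f := fun i => VY i ω) (fun i _ => h0Y i ω) (Finset.mem_univ i)
  have hsψ : ∀ i ω, Vψ i ω ≤ ∑ i, Vψ i ω := fun i ω =>
    Finset.single_le_sum (f := fun i => Vψ i ω) (fun i _ => h0ψ i ω) (Finset.mem_univ i)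
  have hsg : ∀ i j ω, Vg i j ω ≤ ∑ i, ∑ j, Vg i j ω := fun i j ω =>
    (Finset.single_le_sum (f := fun j => Vg i j ω) (fun j _ => h0g i j ω)
      (Finset.mem_univ j)).trans
    (Finset.single_le_sum (f := fun i => ∑ j, Vg i j ω)
      (fun i _ => Finset.sum_nonneg fun j _ => h0g i j ω) (Finset.mem_univ i))
  have hn1 : ∀ ω, 0 ≤ ∑ i, VY i ω := fun ω => Finset.sum_nonneg fun i _ => h0Y i ω
  have hn2 : ∀ ω, 0 ≤ ∑ i, ∑ j, Vg i j ω := fun ω =>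
    Finset.sum_nonneg fun i _ => Finset.sum_nonneg fun j _ => h0g i j ω
  have hn3 : ∀ ω, 0 ≤ ∑ i, Vψ i ω := fun ω => Finset.sum_nonneg fun i _ => h0ψ i ω
  have hgc : ∀ i j ω, Continuous fun t => g i j t (X t ω) := fun i j => (hg i j).2.1
  have hYc : ∀ i ω, Continuous fun t => Y i t ω := fun i => (hY2 i).2.1
  refine ⟨fun ω => (∑ i, VY i ω + ∑ i, ∑ j, Vg i j ω) + ∑ i, Vψ i ω, fun i => ?_⟩
  exact {
    continuous_value := hYc i
    continuous_obstacle := continuous_obstacle hm hgc hYc i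
    continuous_running := continuous_running (hψc i)
    adapted_value := (hY2 i).measurable
    adapted_obstacle := fun t => measurable_obstacle (τ := fun _ => t)
      (fun j => (hg i j).measurable t) fun j => (hY2 j).measurable t
    adapted_running := fun t => measurable_running (hψc i) fun s hs =>
      (((hψ i).1.stronglyAdapted s).mono (F.mono hs)).measurable
    memLp_bound := ((memLp_finsetSum _ fun i _ => hVY i).add
      (memLp_finsetSum _ fun i _ => memLp_finsetSum _ fun j _ => hVg i j)).add
      (memLp_finsetSum _ fun i _ => hVψ i)
    value_le := fun t ω => by linarith [hVY' i t ω, hsY i ω, hn2 ω, hn3 ω]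
    obstacle_le := fun t ω => by
      obtain ⟨j, -, hj⟩ := exists_eq_obstacle (g := g) (X := X) (Y := Y) hm i t ω
      rw [hj]
      have h1 := abs_add_le (-g i j t (X t ω)) (Y j t ω)
      rw [abs_neg] at h1
      linarith [hVY' j t ω, hsY j ω, hVg' i j t ω, hsg i j ω, hn3 ω]
    running_le := fun t ω => by linarith [hVψ' i t ω, hsψ i ω, hn2 ω, hn1 ω]
    isEssSup := fun t => by
      convert hY.1 i t using 1
      ext f
      constructor
      · rintro ⟨τ, hτ, htτ, rfl⟩
        exact ⟨τ, hτ, htτ, by rw [stoppingReward_eq hψc htτ]⟩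
      · rintro ⟨τ, hτ, htτ, rfl⟩
        exact ⟨τ, hτ, htτ, by rw [stoppingReward_eq hψc htτ]⟩
    terminal := hY.2 i }

end Obstacle

end OptimalSwitching

namespace OptimalSwitching

/-! ### Decomposition and domination of the profit of a strategy. -/

section Profit

open Filter Topology

set_option linter.unusedSectionVars false

variable {T : ℝ} [Fact (0 ≤ T)] {Ω : Type*} {mΩ : MeasurableSpace Ω} {k m : ℕ}
  {F : Filtration (Time T) mΩ} {P : Measure Ω}
  {ψ : Fin m → Time T → EuclideanSpace ℝ (Fin k) → ℝ}
  {g : Fin m → Fin m → Time T → EuclideanSpace ℝ (Fin k) → ℝ}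
  {X : Time T → Ω → EuclideanSpace ℝ (Fin k)} {Y : Fin m → Time T → Ω → ℝ}
  {S : Strategy T Ω m}

theorem measurable_select {m' : MeasurableSpace Ω} {ι β : Type*} [Countable ι]
    [MeasurableSpace ι] [DiscreteMeasurableSpace ι] [MeasurableSpace β] {f : ι → Ω → β}
    {ξ : Ω → ι} (hf : ∀ i, Measurable[m'] (f i)) (hξ : Measurable[m'] ξ) :
    Measurable[m'] fun ω => f (ξ ω) ω := by
  have h : Measurable fun p : ι × Ω => f p.1 p.2 := measurable_from_prod_countable_right hf
  exact h.comp (hξ.prodMk measurable_id)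

open Classical in
/-- The profit collected up to the `n`-th switching time. -/
noncomputable def Strategy.partialProfit (S : Strategy T Ω m)
    (ψ : Fin m → Time T → EuclideanSpace ℝ (Fin k) → ℝ)
    (g : Fin m → Fin m → Time T → EuclideanSpace ℝ (Fin k) → ℝ)
    (X : Time T → Ω → EuclideanSpace ℝ (Fin k)) (n : ℕ) (ω : Ω) : ℝ :=
  ∑ l ∈ Finset.range n, ((∫ s in Set.Ioc (S.τ l ω) (S.τ (l + 1) ω), ψ (S.ξ l ω) s (X s ω) ∂leb T) -
    if S.τ (l + 1) ω < ⊤ then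
      g (S.ξ l ω) (S.ξ (l + 1) ω) (S.τ (l + 1) ω) (X (S.τ (l + 1) ω) ω) else 0)

theorem Strategy.mode_eq {ω : Ω} (hmono : Monotone fun n => S.τ n ω) {l : ℕ} {s : Time T}
    (hs : s ∈ Set.Ioc (S.τ l ω) (S.τ (l + 1) ω)) : S.mode s ω = S.ξ l ω := by
  classical
  have h : ∃ n, S.τ n ω < s ∧ s ≤ S.τ (n + 1) ω := ⟨l, hs⟩
  have hfind : Nat.find h = l := by
    refine (Nat.find_eq_iff h).2 ⟨hs, fun n hn hcon => ?_⟩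
    exact (hcon.2.trans (hmono hn)).not_gt hs.1
  rw [Strategy.mode, dif_pos h]
  convert rfl
  exact hfind.symm

theorem Strategy.setIntegral_mode (hψ : ∀ i ω, Continuous fun t => ψ i t (X t ω)) {ω : Ω}
    (hmono : Monotone fun n => S.τ n ω) (h0 : S.τ 0 ω = ⊥) (n : ℕ) :
    IntegrableOn (fun s => ψ (S.mode s ω) s (X s ω)) (Set.Ioc ⊥ (S.τ n ω)) (leb T) ∧
    ∫ s in Set.Ioc ⊥ (S.τ n ω), ψ (S.mode s ω) s (X s ω) ∂leb T =
      ∑ l ∈ Finset.range n,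
        ∫ s in Set.Ioc (S.τ l ω) (S.τ (l + 1) ω), ψ (S.ξ l ω) s (X s ω) ∂leb T := by
  induction n with
  | zero => simp [h0]
  | succ n ih =>
    have heq : Set.EqOn (fun s => ψ (S.ξ n ω) s (X s ω)) (fun s => ψ (S.mode s ω) s (X s ω))
        (Set.Ioc (S.τ n ω) (S.τ (n + 1) ω)) := fun s hs => by
      simp only [Strategy.mode_eq hmono hs]
    have hi : IntegrableOn (fun s => ψ (S.mode s ω) s (X s ω))
        (Set.Ioc (S.τ n ω) (S.τ (n + 1) ω)) (leb T) :=
      (integrable_path (hψ (S.ξ n ω) ω)).integrableOn.congr_fun heq measurableSet_Ioc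
    have hle : S.τ n ω ≤ S.τ (n + 1) ω := hmono n.le_succ
    rw [← Set.Ioc_union_Ioc_eq_Ioc bot_le hle]
    refine ⟨ih.1.union hi, ?_⟩
    rw [setIntegral_union (Set.Ioc_disjoint_Ioc_of_le le_rfl) measurableSet_Ioc ih.1 hi, ih.2,
      Finset.sum_range_succ, setIntegral_congr_fun measurableSet_Ioc heq]

/-- After the horizon is reached no cost is charged, and the periods `(τ l, τ (l+1)]` cover
everything but the null set `{⊥}`. -/
theorem Strategy.profit_eq_partialProfit (hψ : ∀ i ω, Continuous fun t => ψ i t (X t ω)) {ω : Ω}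
    (hmono : Monotone fun n => S.τ n ω) (h0 : S.τ 0 ω = ⊥) {n : ℕ} (hn : S.τ n ω = ⊤) :
    S.profit ψ g X ω = S.partialProfit ψ g X n ω := by
  have h1 : ∫ s, ψ (S.mode s ω) s (X s ω) ∂leb T =
      ∫ s in Set.Ioc ⊥ (S.τ n ω), ψ (S.mode s ω) s (X s ω) ∂leb T := by
    have hae : (Set.Ioc ⊥ (S.τ n ω) : Set (Time T)) =ᵐ[leb T] Set.univ := by
      rw [hn, ae_eq_univ]
      have : (Set.Ioc (⊥ : Time T) ⊤)ᶜ = {⊥} := by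
        ext s
        simp
      rw [this]
      exact measure_singleton _
    rw [setIntegral_congr_set hae, setIntegral_univ]
  have h2 : S.totalCost g X ω = ∑ l ∈ Finset.range n, if S.τ (l + 1) ω < ⊤ then
      g (S.ξ l ω) (S.ξ (l + 1) ω) (S.τ (l + 1) ω) (X (S.τ (l + 1) ω) ω) else 0 := by
    refine tsum_eq_sum fun l hl => if_neg ?_
    have hnl : n ≤ l + 1 := by
      have := Finset.mem_range.not.1 hl
      omega
    have := hmono hnl
    simp only [hn, top_le_iff] at this
    rw [this]
    exact lt_irrefl _
  rw [Strategy.profit, h1, (Strategy.setIntegral_mode hψ hmono h0 n).2, h2,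
    ← Finset.sum_sub_distrib, Strategy.partialProfit]

theorem Strategy.abs_integral_mode_le (hψ : ∀ i ω, Continuous fun t => ψ i t (X t ω)) (ω : Ω) :
    |∫ s, ψ (S.mode s ω) s (X s ω) ∂leb T| ≤ ∑ i, ∫ s, |ψ i s (X s ω)| ∂leb T := by
  have hi : ∀ i, Integrable (fun s => |ψ i s (X s ω)|) (leb T) := fun i =>
    (integrable_path (hψ i ω)).abs
  rw [← integral_finsetSum _ fun i _ => hi i]
  refine abs_integral_le_integral_abs.trans ?_
  refine integral_mono_of_nonneg (ae_of_all _ fun s => abs_nonneg _)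
    (integrable_finsetSum _ fun i _ => hi i) (ae_of_all _ fun s => ?_)
  exact Finset.single_le_sum (f := fun i => |ψ i s (X s ω)|) (fun i _ => abs_nonneg _)
    (Finset.mem_univ (S.mode s ω))

theorem IsAdmissible.monotone {i₀ : Fin m} (hS : IsAdmissible F P i₀ S) (ω : Ω) :
    Monotone fun n => S.τ n ω := monotone_nat_of_le_succ fun n => hS.mono n ω

theorem IsAdmissible.ae_exists_top {i₀ : Fin m} (hS : IsAdmissible F P i₀ S) :
    ∀ᵐ ω ∂P, ∃ n, S.τ n ω = ⊤ := by
  rw [ae_iff]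
  refine measure_mono_null (t := {ω | ∀ n, S.τ n ω < ⊤}) (fun ω hω => ?_) hS.finite_switching
  intro n
  exact lt_top_iff_ne_top.2 fun hn => hω ⟨n, hn⟩

theorem Strategy.measurable_partialProfit (hψ : ∀ i ω, Continuous fun t => ψ i t (X t ω))
    (hψm : ∀ i t, Measurable fun ω => ψ i t (X t ω))
    (hg : ∀ i j ω, Continuous fun t => g i j t (X t ω))
    (hgm : ∀ i j t, Measurable fun ω => g i j t (X t ω)) (hτ : ∀ n, Measurable (S.τ n))
    (hτmono : ∀ n ω, S.τ n ω ≤ S.τ (n + 1) ω)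
    (hξ : ∀ n, Measurable (S.ξ n)) (n : ℕ) : Measurable (S.partialProfit ψ g X n) := by
  classical
  refine Finset.measurable_sum _ fun l _ => Measurable.sub ?_ ?_
  · have hr : ∀ i t, Measurable (running (fun t ω => ψ i t (X t ω)) t) := fun i t =>
      measurable_running (hψ i) fun s _ => hψm i s
    have h : ∀ i, Measurable fun ω =>
        ∫ s in Set.Ioc (S.τ l ω) (S.τ (l + 1) ω), ψ i s (X s ω) ∂leb T := fun i => by
      have := (measurable_eval (hr i) (continuous_running (hψ i)) (hτ (l + 1))).sub
        (measurable_eval (hr i) (continuous_running (hψ i)) (hτ l))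
      refine (congrArg Measurable (funext fun ω => ?_)).mp this
      exact running_sub (hψ i) (hτmono l ω) ω
    exact measurable_select h (hξ l)
  · refine Measurable.ite (measurableSet_lt (hτ (l + 1)) measurable_const) ?_ measurable_const
    have h : ∀ i j, Measurable fun ω => g i j (S.τ (l + 1) ω) (X (S.τ (l + 1) ω) ω) :=
      fun i j => measurable_eval (w := fun t ω => g i j t (X t ω)) (hgm i j) (hg i j) (hτ (l + 1))
    exact measurable_select (fun i => measurable_select (h i) (hξ (l + 1))) (hξ l)

/-- The `σ`-algebras at the switching times. -/
noncomputable def switchingFiltration (F : Filtration (Time T) mΩ) {τ : ℕ → Ω → Time T}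
    (hτ : ∀ n, IsStopping F (τ n)) (hmono : ∀ n ω, τ n ω ≤ τ (n + 1) ω) : Filtration ℕ mΩ where
  seq n := IsStoppingTime.measurableSpace (hτ n)
  mono' := monotone_nat_of_le_succ fun n => (hτ n).mono_measurableSpace (hτ (n + 1)) (hmono n)
  le' n := (hτ n).measurableSpace_le

/-- The sum of `Y^i` and of the running profit in mode `i`. -/
noncomputable def gain (ψ : Fin m → Time T → EuclideanSpace ℝ (Fin k) → ℝ)
    (X : Time T → Ω → EuclideanSpace ℝ (Fin k)) (Y : Fin m → Time T → Ω → ℝ)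
    (i : Fin m) (t : Time T) (ω : Ω) : ℝ :=
  Y i t ω + running (fun t ω => ψ i t (X t ω)) t ω

variable [IsProbabilityMeasure P] {W : Ω → ℝ}

/-- The gain accumulated by a strategy is dominated by a martingale that converges almost surely
and in mean. -/
theorem exists_limit_gain (hT : 0 < T) (hW : MemLp W 2 P)
    (h : ∀ i, IsSnellEnvelope F P (Y i) (obstacle g X Y i)
      (running fun t ω => ψ i t (X t ω)) W)
    (hτ : ∀ n, IsStopping F (S.τ n)) (hmono : ∀ n ω, S.τ n ω ≤ S.τ (n + 1) ω)
    (hξ : ∀ n, Measurable[IsStoppingTime.measurableSpace (hτ n)] (S.ξ n)) :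
    ∃ (M : ℕ → Ω → ℝ) (L : Ω → ℝ), Integrable L P ∧ ∫ ω, L ω ∂P = 0 ∧
      (∀ᵐ ω ∂P, Tendsto (fun n => M n ω) atTop (𝓝 (L ω))) ∧
      (∀ᵐ ω ∂P, ∀ n, ∑ l ∈ Finset.range n,
        (gain ψ X Y (S.ξ l ω) (S.τ (l + 1) ω) ω - gain ψ X Y (S.ξ l ω) (S.τ l ω) ω) ≤ M n ω) ∧
      ((∀ i n B, MeasurableSet[IsStoppingTime.measurableSpace (hτ n)] B →
          ∫ ω in B ∩ {ω | S.ξ n ω = i},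
            (gain ψ X Y i (S.τ (n + 1) ω) ω - gain ψ X Y i (S.τ n ω) ω) ∂P = 0) →
        ∀ᵐ ω ∂P, ∀ n, ∑ l ∈ Finset.range n,
          (gain ψ X Y (S.ξ l ω) (S.τ (l + 1) ω) ω - gain ψ X Y (S.ξ l ω) (S.τ l ω) ω) =
            M n ω) := by
  set 𝒢 := switchingFiltration F hτ hmono with h𝒢
  -- For each `i` this is a discrete supermartingale by optional stopping, and `A i n` is known at
  -- `τ n`. Exactly one of the finitely many `A i n` contains a given `ω`, so summing over `i`
  -- recovers the gain in the mode in force.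
  set Z : Fin m → ℕ → Ω → ℝ := fun i n ω => gain ψ X Y i (S.τ n ω) ω with hZdef
  set A : Fin m → ℕ → Set Ω := fun i n => {ω | S.ξ n ω = i} with hAdef
  have hW2 : MemLp (fun ω => 2 * W ω) 2 P := hW.const_mul 2
  have hZW : ∀ i n ω, |Z i n ω| ≤ 2 * W ω := fun i n ω => (h i).sum_le _ ω
  have hZi : ∀ i n, Integrable (Z i n) P := fun i n => (h i).integrable_sum (hτ n).measurable
  have hZm : ∀ i, StronglyAdapted 𝒢 (Z i) := fun i n => by
    have hp : IsStronglyProgressive F (gain ψ X Y i) :=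
      StronglyAdapted.isStronglyProgressive_of_continuous (fun t =>
        (((h i).adapted_value t).add ((h i).adapted_running t)).stronglyMeasurable)
        (h i).continuous_sum
    exact ((hτ n).measurable_eval hp).stronglyMeasurable
  have hZ : ∀ i, Supermartingale (Z i) 𝒢 P := fun i =>
    supermartingale_of_setIntegral_succ_le (hZm i) (hZi i) fun n B hB => by
      have h1 := (h i).stopped_le hT (hτ n) (hτ (n + 1)) (hmono n) hB
      have h2 := integral_sub (hZi i (n + 1)).integrableOn
        (hZi i n).integrableOn (μ := P.restrict B)
      have h3 : ∫ ω in B, (Z i (n + 1) ω - Z i n ω) ∂P ≤ 0 := h1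
      linarith
  have hA : ∀ i n, MeasurableSet[𝒢 n] (A i n) := fun i n =>
    hξ n (measurableSet_singleton i)
  choose L hLi hL0 hL using fun i => exists_limit_selectedMartingale (hZ i) hW2 (hZW i) (hA i)
  have hsum : ∀ ω l, ∑ i, (A i l).indicator (fun ω => Z i (l + 1) ω - Z i l ω) ω =
      gain ψ X Y (S.ξ l ω) (S.τ (l + 1) ω) ω - gain ψ X Y (S.ξ l ω) (S.τ l ω) ω := fun ω l => by
    rw [Finset.sum_eq_single (S.ξ l ω)]
    · rw [Set.indicator_of_mem (show ω ∈ A (S.ξ l ω) l from rfl)]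
    · intro i _ hi
      exact Set.indicator_of_notMem (fun hω : ω ∈ A i l => hi (Eq.symm hω)) _
    · exact fun hi => absurd (Finset.mem_univ _) hi
  refine ⟨fun n ω => ∑ i, selectedMartingale P 𝒢 (Z i) (A i) n ω, fun ω => ∑ i, L i ω,
    integrable_finsetSum _ fun i _ => hLi i, ?_, ?_, ?_, fun h0 => ?_⟩
  · rw [integral_finsetSum _ fun i _ => hLi i]
    exact Finset.sum_eq_zero fun i _ => hL0 i
  · filter_upwards [ae_all_iff.2 hL] with ω hω
    exact tendsto_finsetSum _ fun i _ => hω i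
  · filter_upwards [ae_all_iff.2 fun i => sum_indicator_le_selectedMartingale (hZ i) (A := A i)]
      with ω hω n
    simp only [← hsum]
    rw [Finset.sum_comm]
    exact Finset.sum_le_sum fun i _ => hω i n
  · filter_upwards [ae_all_iff.2 fun i => sum_indicator_eq_selectedMartingale (hZi i) (hA i)
      fun n B hB => h0 i n B hB] with ω hω n
    simp only [← hsum]
    rw [Finset.sum_comm]
    exact Finset.sum_congr rfl fun i _ => hω i n

open Classical in
/-- The loss incurred by switching at the `(n + 1)`-st switching time. -/
noncomputable def Strategy.loss (S : Strategy T Ω m)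
    (g : Fin m → Fin m → Time T → EuclideanSpace ℝ (Fin k) → ℝ)
    (X : Time T → Ω → EuclideanSpace ℝ (Fin k)) (Y : Fin m → Time T → Ω → ℝ)
    (n : ℕ) (ω : Ω) : ℝ :=
  Y (S.ξ n ω) (S.τ (n + 1) ω) ω - Y (S.ξ (n + 1) ω) (S.τ (n + 1) ω) ω +
    if S.τ (n + 1) ω < ⊤ then
      g (S.ξ n ω) (S.ξ (n + 1) ω) (S.τ (n + 1) ω) (X (S.τ (n + 1) ω) ω) else 0

theorem Strategy.partialProfit_eq (hψ : ∀ i ω, Continuous fun t => ψ i t (X t ω)) {ω : Ω}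
    (hmono : ∀ n, S.τ n ω ≤ S.τ (n + 1) ω) (n : ℕ) :
    S.partialProfit ψ g X n ω = Y (S.ξ 0 ω) (S.τ 0 ω) ω - Y (S.ξ n ω) (S.τ n ω) ω +
      ∑ l ∈ Finset.range n,
        (gain ψ X Y (S.ξ l ω) (S.τ (l + 1) ω) ω - gain ψ X Y (S.ξ l ω) (S.τ l ω) ω) -
      ∑ l ∈ Finset.range n, S.loss g X Y l ω := by
  induction n with
  | zero => simp [Strategy.partialProfit]
  | succ n ih =>
    have hr := running_sub (w := fun t ω' => ψ (S.ξ n ω) t (X t ω')) (hψ (S.ξ n ω)) (hmono n) ω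
    have hstep : S.partialProfit ψ g X (n + 1) ω = S.partialProfit ψ g X n ω +
        ((∫ s in Set.Ioc (S.τ n ω) (S.τ (n + 1) ω), ψ (S.ξ n ω) s (X s ω) ∂leb T) -
          if S.τ (n + 1) ω < ⊤ then
            g (S.ξ n ω) (S.ξ (n + 1) ω) (S.τ (n + 1) ω) (X (S.τ (n + 1) ω) ω) else 0) :=
      Finset.sum_range_succ _ _
    rw [hstep, ih, Finset.sum_range_succ, Finset.sum_range_succ]
    simp only [gain, Strategy.loss]
    linarith

/-- A genuine switch pays at most the obstacle, a switch from a mode to itself is free, and at the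
horizon all values vanish. -/
theorem Strategy.loss_nonneg (hg_diag : ∀ i t x, g i i t x = 0) {ω : Ω}
    (hobs : ∀ i t, obstacle g X Y i t ω ≤ Y i t ω) (hterm : ∀ i, Y i ⊤ ω = 0) (n : ℕ) :
    0 ≤ S.loss g X Y n ω := by
  rw [Strategy.loss]
  split_ifs with hlt
  · by_cases hij : S.ξ (n + 1) ω = S.ξ n ω
    · rw [hij, hg_diag]
      simp
    · linarith [le_obstacle (g := g) (X := X) (Y := Y) hij (S.τ (n + 1) ω) ω,
        hobs (S.ξ n ω) (S.τ (n + 1) ω)]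
  · rw [not_lt_top_iff.1 hlt, hterm, hterm]
    simp

theorem Strategy.loss_eq_zero {ω : Ω} {n : ℕ} (hterm : ∀ i, Y i ⊤ ω = 0)
    (h : S.τ (n + 1) ω < ⊤ → Y (S.ξ n ω) (S.τ (n + 1) ω) ω =
      -g (S.ξ n ω) (S.ξ (n + 1) ω) (S.τ (n + 1) ω) (X (S.τ (n + 1) ω) ω) +
        Y (S.ξ (n + 1) ω) (S.τ (n + 1) ω) ω) :
    S.loss g X Y n ω = 0 := by
  rw [Strategy.loss]
  split_ifs with hlt
  · rw [h hlt]
    ring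
  · rw [not_lt_top_iff.1 hlt, hterm, hterm]
    simp

/-- The profit of an admissible strategy is dominated by an integrable random variable whose mean
is the initial value, with equality if each switching time is optimal and no switching incurs a
loss. -/
theorem IsAdmissible.exists_profit_le (hT : 0 < T) (hW : MemLp W 2 P)
    (h : ∀ i, IsSnellEnvelope F P (Y i) (obstacle g X Y i)
      (running fun t ω => ψ i t (X t ω)) W)
    (hψ : ∀ i ω, Continuous fun t => ψ i t (X t ω)) (hg_diag : ∀ i t x, g i i t x = 0)
    {i₀ : Fin m} (hS : IsAdmissible F P i₀ S) :
    ∃ R : Ω → ℝ, Integrable R P ∧ ∫ ω, R ω ∂P = ∫ ω, Y i₀ ⊥ ω ∂P ∧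
      S.profit ψ g X ≤ᵐ[P] R ∧
      ((∀ i n B, MeasurableSet[IsStoppingTime.measurableSpace (hS.stopping n)] B →
          ∫ ω in B ∩ {ω | S.ξ n ω = i},
            (gain ψ X Y i (S.τ (n + 1) ω) ω - gain ψ X Y i (S.τ n ω) ω) ∂P = 0) →
        (∀ n ω, S.τ (n + 1) ω < ⊤ → Y (S.ξ n ω) (S.τ (n + 1) ω) ω =
          -g (S.ξ n ω) (S.ξ (n + 1) ω) (S.τ (n + 1) ω) (X (S.τ (n + 1) ω) ω) +
            Y (S.ξ (n + 1) ω) (S.τ (n + 1) ω) ω) →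
        S.profit ψ g X =ᵐ[P] R) := by
  obtain ⟨M, L, hLi, hL0, hML, hle, heq⟩ := exists_limit_gain hT hW h hS.stopping hS.mono
    fun n => hS.measurable_mode n (hS.stopping n)
  have hYi : Integrable (fun ω => Y i₀ ⊥ ω) P :=
    (h i₀).integrable_value (τ := fun _ => ⊥) measurable_const
  have hterm : ∀ᵐ ω ∂P, ∀ i, Y i ⊤ ω = 0 := ae_all_iff.2 fun i => (h i).terminal
  have hprofit : ∀ ω, (∀ i, Y i ⊤ ω = 0) → ∀ N n, S.τ N ω = ⊤ → N ≤ n →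
      S.profit ψ g X ω = Y i₀ ⊥ ω + (∑ l ∈ Finset.range n,
        (gain ψ X Y (S.ξ l ω) (S.τ (l + 1) ω) ω - gain ψ X Y (S.ξ l ω) (S.τ l ω) ω) -
      ∑ l ∈ Finset.range n, S.loss g X Y l ω) := fun ω hω N n hN hn => by
    have hn' : S.τ n ω = ⊤ := top_unique (hN ▸ hS.monotone ω hn)
    rw [Strategy.profit_eq_partialProfit hψ (hS.monotone ω) (hS.τ_zero ω) hn',
      Strategy.partialProfit_eq (Y := Y) hψ (fun n => hS.mono n ω), hn', hω, hS.τ_zero, hS.ξ_zero]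
    ring
  refine ⟨fun ω => Y i₀ ⊥ ω + L ω, hYi.add hLi, ?_, ?_, fun h0 hloss => ?_⟩
  · rw [integral_add hYi hLi, hL0, add_zero]
  · filter_upwards [hML, hle, hterm, hS.ae_exists_top,
      ae_all_iff.2 fun i => (h i).obstacle_le_value hT] with ω hMω hleω htω ⟨N, hN⟩ hobs
    -- The profit equals the decomposition at every `n ≥ N`, so the constant left side is compared
    -- with the limit of `M n`.
    refine ge_of_tendsto (hMω.const_add _) ?_
    filter_upwards [eventually_ge_atTop N] with n hn
    rw [hprofit ω htω N n hN hn]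
    have hpos : 0 ≤ ∑ l ∈ Finset.range n, S.loss g X Y l ω :=
      Finset.sum_nonneg fun l _ => Strategy.loss_nonneg hg_diag hobs htω l
    linarith [hleω n]
  · filter_upwards [hML, heq h0, hterm, hS.ae_exists_top] with ω hMω heqω htω ⟨N, hN⟩
    refine tendsto_nhds_unique_of_eventuallyEq tendsto_const_nhds (hMω.const_add _) ?_
    filter_upwards [eventually_ge_atTop N] with n hn
    rw [hprofit ω htω N n hN hn, heqω n, Finset.sum_eq_zero fun l _ =>
      Strategy.loss_eq_zero htω (hloss l ω), sub_zero]

end Profit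

end OptimalSwitching

namespace OptimalSwitching

/-! ### Strategies of first hitting times. -/

section FirstHitting

open Filter Topology

set_option linter.unusedSectionVars false

/-- Take the shortest return of the sequence to an earlier value: minimality makes the values in
between distinct, and `hs` excludes length `1`. -/
theorem exists_loop {ι : Type*} [Finite ι] {s : ℕ → ι} (hs : ∀ n, s (n + 1) ≠ s n) :
    ∃ a n, 2 ≤ n ∧ Set.InjOn (fun l => s (a + l)) (Set.Iio n) ∧ s (a + n) = s a := by
  classical
  have hex : ∃ n, 1 ≤ n ∧ ∃ a, s (a + n) = s a := by
    obtain ⟨x, y, hxy, h⟩ := Finite.exists_ne_map_eq_of_infinite s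
    rcases lt_or_gt_of_ne hxy with hlt | hlt
    · exact ⟨y - x, by omega, x, by rw [h]; congr 1; omega⟩
    · exact ⟨x - y, by omega, y, by rw [← h]; congr 1; omega⟩
  obtain ⟨hn, a, ha⟩ := Nat.find_spec hex
  have hmin : ∀ p q, p < q → q < Nat.find hex → s (a + p) ≠ s (a + q) := fun p q hpq hq h => by
    refine Nat.find_min hex (m := q - p) (by omega) ⟨by omega, a + p, ?_⟩
    rw [h]
    congr 1
    omega
  refine ⟨a, Nat.find hex, ?_, fun p hp q hq h => ?_, ha⟩
  · by_contra hlt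
    have h1 : Nat.find hex = 1 := by omega
    rw [h1] at ha
    exact hs a ha
  · by_contra hne
    rcases lt_or_gt_of_ne hne with hlt | hlt
    · exact hmin p q hlt hq h
    · exact hmin q p hlt hp h.symm

variable {T : ℝ} [Fact (0 ≤ T)] {Ω : Type*} {mΩ : MeasurableSpace Ω} {k m : ℕ}
  {F : Filtration (Time T) mΩ} {P : Measure Ω}
  {ψ : Fin m → Time T → EuclideanSpace ℝ (Fin k) → ℝ}
  {g : Fin m → Fin m → Time T → EuclideanSpace ℝ (Fin k) → ℝ}
  {X : Time T → Ω → EuclideanSpace ℝ (Fin k)} {Y : Fin m → Time T → Ω → ℝ}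
  {S : Strategy T Ω m} {i₀ : Fin m} {W : Ω → ℝ} [IsProbabilityMeasure P]

/-- Since `σ ≤ ρ i`, the event `σ ≤ t` can be inserted into `{ρ i ≤ t}`, and on it the value of `ξ`
is known at time `t`. -/
theorem IsStopping.select {ι : Type*} [Countable ι] [MeasurableSpace ι]
    [DiscreteMeasurableSpace ι] {σ : Ω → Time T} (hσ : IsStopping F σ) {ξ : Ω → ι}
    (hξ : Measurable[IsStoppingTime.measurableSpace hσ] ξ) {ρ : ι → Ω → Time T}
    (hρ : ∀ i, IsStopping F (ρ i)) (hle : ∀ i ω, σ ω ≤ ρ i ω) :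
    IsStopping F fun ω => ρ (ξ ω) ω := by
  refine isStopping_iff.2 fun t => ?_
  have heq : {ω | ρ (ξ ω) ω ≤ t} = ⋃ i, (ξ ⁻¹' {i} ∩ {ω | σ ω ≤ t}) ∩ {ω | ρ i ω ≤ t} := by
    ext ω
    simp only [Set.mem_ofPred_eq, Set.mem_iUnion, Set.mem_inter_iff, Set.mem_preimage,
      Set.mem_singleton_iff]
    constructor
    · exact fun h => ⟨ξ ω, ⟨rfl, (hle _ ω).trans h⟩, h⟩
    · rintro ⟨i, ⟨rfl, -⟩, h⟩
      exact h
  rw [heq]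
  exact MeasurableSet.iUnion fun i =>
    (hσ.measurableSet_inter (hξ (measurableSet_singleton i)) t).inter (isStopping_iff.1 (hρ i) t)

/-- The first time after `s` at which `Y^i` meets its obstacle, or the horizon if there is none. -/
noncomputable def contactTime (g : Fin m → Fin m → Time T → EuclideanSpace ℝ (Fin k) → ℝ)
    (X : Time T → Ω → EuclideanSpace ℝ (Fin k)) (Y : Fin m → Time T → Ω → ℝ)
    (i : Fin m) (s : Time T) (ω : Ω) : Time T :=
  firstHit (fun t ω => Y i t ω - obstacle g X Y i t ω) s ω

theorem sInf_contact_eq (i : Fin m) (s : Time T) (ω : Ω) :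
    sInf {r : Time T | s ≤ r ∧ Y i r ω = obstacle g X Y i r ω} = contactTime g X Y i s ω := by
  simp only [contactTime, firstHit, sub_eq_zero]

theorem eq_obstacle_of_contactTime_lt (hm : 2 ≤ m)
    (hg : ∀ i j ω, Continuous fun t => g i j t (X t ω)) (hY : ∀ i ω, Continuous fun t => Y i t ω)
    {i : Fin m} {s : Time T} {ω : Ω} (hlt : contactTime g X Y i s ω < ⊤) :
    Y i (contactTime g X Y i s ω) ω = obstacle g X Y i (contactTime g X Y i s ω) ω :=
  sub_eq_zero.1 (firstHit_eq_zero (h := fun t ω => Y i t ω - obstacle g X Y i t ω)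
    (fun ω => (hY i ω).sub (continuous_obstacle hm hg hY i ω)) hlt)

theorem isStopping_contactTime
    (h : ∀ i, IsSnellEnvelope F P (Y i) (obstacle g X Y i)
      (running fun t ω => ψ i t (X t ω)) W) {σ : Ω → Time T} (hσ : IsStopping F σ) (i : Fin m) :
    IsStopping F fun ω => contactTime g X Y i (σ ω) ω := (h i).isStopping_firstHit hσ

namespace IsFirstHitting

theorem τ_succ_eq (hS : IsFirstHitting g X Y F i₀ S) (n : ℕ) (ω : Ω) :
    S.τ (n + 1) ω = contactTime g X Y (S.ξ n ω) (S.τ n ω) ω := by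
  rw [hS.τ_succ, sInf_contact_eq]

theorem mono (hS : IsFirstHitting g X Y F i₀ S) (n : ℕ) (ω : Ω) :
    S.τ n ω ≤ S.τ (n + 1) ω := by
  rw [hS.τ_succ_eq]
  exact le_firstHit _ _

theorem isStopping (hS : IsFirstHitting g X Y F i₀ S)
    (h : ∀ i, IsSnellEnvelope F P (Y i) (obstacle g X Y i)
      (running fun t ω => ψ i t (X t ω)) W) (n : ℕ) : IsStopping F (S.τ n) := by
  induction n with
  | zero =>
    rw [funext hS.τ_zero]
    exact isStopping_const ⊥
  | succ n ih =>
    rw [funext (hS.τ_succ_eq n)]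
    exact ih.select (hS.measurable_mode n ih) (isStopping_contactTime h ih)
      fun i ω => le_firstHit _ _

theorem value_eq (hS : IsFirstHitting g X Y F i₀ S) (hm : 2 ≤ m)
    (hg : ∀ i j ω, Continuous fun t => g i j t (X t ω)) (hY : ∀ i ω, Continuous fun t => Y i t ω)
    (n : ℕ) (ω : Ω) (hlt : S.τ (n + 1) ω < ⊤) : Y (S.ξ n ω) (S.τ (n + 1) ω) ω =
      -g (S.ξ n ω) (S.ξ (n + 1) ω) (S.τ (n + 1) ω) (X (S.τ (n + 1) ω) ω) +
        Y (S.ξ (n + 1) ω) (S.τ (n + 1) ω) ω := by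
  rw [← (hS.ξ_succ n ω hlt).2]
  rw [hS.τ_succ_eq] at hlt ⊢
  exact eq_obstacle_of_contactTime_lt hm hg hY hlt

/-- Since there is no free loop, a strategy of first hitting times switches finitely often. -/
theorem exists_eq_top (hS : IsFirstHitting g X Y F i₀ S) (hm : 2 ≤ m)
    (hg : ∀ i j ω, Continuous fun t => g i j t (X t ω)) (hY : ∀ i ω, Continuous fun t => Y i t ω)
    (hg_loop : ∀ (n : ℕ) (c : ℕ → Fin m), 2 ≤ n → Set.InjOn c (Set.Iio n) → c n = c 0 →
      ∀ t x, 0 < ∑ l ∈ Finset.range n, g (c l) (c (l + 1)) t x) (ω : Ω) :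
    ∃ n, S.τ n ω = ⊤ := by
  by_contra! hcon
  have hlt : ∀ n, S.τ n ω < ⊤ := fun n => lt_top_iff_ne_top.2 (hcon n)
  set t := ⨆ n, S.τ n ω with ht
  have hlim : Tendsto (fun n => S.τ (n + 1) ω) atTop (𝓝 t) :=
    (tendsto_atTop_iSup (monotone_nat_of_le_succ fun n => hS.mono n ω)).comp
      (tendsto_add_atTop_nat 1)
  set φ : Fin m → Fin m → Time T → ℝ := fun i j t => g i j t (X t ω) - Y j t ω + Y i t ω with hφ
  have hφc : ∀ i j, Continuous (φ i j) := fun i j => ((hg i j ω).sub (hY j ω)).add (hY i ω)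
  have hφ0 : ∀ n, φ (S.ξ n ω) (S.ξ (n + 1) ω) (S.τ (n + 1) ω) = 0 := fun n => by
    have := hS.value_eq hm hg hY n ω (hlt (n + 1))
    simp only [hφ, this]
    ring
  have hev : ∀ᶠ n in atTop, ∀ i j, φ i j t ≠ 0 → φ i j (S.τ (n + 1) ω) ≠ 0 :=
    eventually_all.2 fun i => eventually_all.2 fun j => by
      by_cases h0 : φ i j t = 0
      · exact Eventually.of_forall fun n hn => absurd h0 hn
      · filter_upwards [((hφc i j).tendsto t |>.comp hlim).eventually_ne h0] with n hn _ using hn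
  obtain ⟨K, hK⟩ := eventually_atTop.1 hev
  have hzero : ∀ n, φ (S.ξ (K + n) ω) (S.ξ (K + n + 1) ω) t = 0 := fun n => by
    by_contra hne
    exact hK (K + n) (by omega) _ _ hne (hφ0 _)
  obtain ⟨a, n, hn, hinj, hloop⟩ := exists_loop (s := fun n => S.ξ (K + n) ω)
    fun n => (hS.ξ_succ (K + n) ω (hlt _)).1
  have hpos := hg_loop n (fun l => S.ξ (K + (a + l)) ω) hn hinj hloop t (X t ω)
  have hsum : ∑ l ∈ Finset.range n,
      g (S.ξ (K + (a + l)) ω) (S.ξ (K + (a + (l + 1))) ω) t (X t ω) =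
      ∑ l ∈ Finset.range n, (Y (S.ξ (K + (a + (l + 1))) ω) t ω - Y (S.ξ (K + (a + l)) ω) t ω) :=
    Finset.sum_congr rfl fun l _ => by
      have := hzero (a + l)
      simp only [hφ] at this
      rw [show K + (a + (l + 1)) = K + (a + l) + 1 by ring]
      linarith
  rw [hsum, Finset.sum_range_sub (fun l => Y (S.ξ (K + (a + l)) ω) t ω)] at hpos
  simp only [add_zero] at hpos hloop
  rw [hloop, sub_self] at hpos
  exact lt_irrefl _ hpos

theorem isAdmissible (hS : IsFirstHitting g X Y F i₀ S) (hm : 2 ≤ m)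
    (hg : ∀ i j ω, Continuous fun t => g i j t (X t ω)) (hY : ∀ i ω, Continuous fun t => Y i t ω)
    (hg_loop : ∀ (n : ℕ) (c : ℕ → Fin m), 2 ≤ n → Set.InjOn c (Set.Iio n) → c n = c 0 →
      ∀ t x, 0 < ∑ l ∈ Finset.range n, g (c l) (c (l + 1)) t x)
    (h : ∀ i, IsSnellEnvelope F P (Y i) (obstacle g X Y i)
      (running fun t ω => ψ i t (X t ω)) W) : IsAdmissible F P i₀ S where
  τ_zero := hS.τ_zero
  ξ_zero := hS.ξ_zero
  mono := hS.mono
  stopping := hS.isStopping h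
  measurable_mode := hS.measurable_mode
  finite_switching := by
    refine (congrArg P (Set.eq_empty_of_forall_notMem fun ω hω => ?_)).trans measure_empty
    obtain ⟨n, hn⟩ := hS.exists_eq_top hm hg hY hg_loop ω
    exact (hω n).ne hn

/-- The gain in the current mode is a martingale between two successive first hitting times. -/
theorem setIntegral_gain_eq_zero (hS : IsFirstHitting g X Y F i₀ S) (hT : 0 < T)
    (h : ∀ i, IsSnellEnvelope F P (Y i) (obstacle g X Y i)
      (running fun t ω => ψ i t (X t ω)) W)
    {n : ℕ} (hτ : IsStopping F (S.τ n)) (i : Fin m) {B : Set Ω}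
    (hB : MeasurableSet[IsStoppingTime.measurableSpace hτ] B) :
    ∫ ω in B ∩ {ω | S.ξ n ω = i},
      (gain ψ X Y i (S.τ (n + 1) ω) ω - gain ψ X Y i (S.τ n ω) ω) ∂P = 0 := by
  have hA : MeasurableSet[IsStoppingTime.measurableSpace hτ] (B ∩ {ω | S.ξ n ω = i}) :=
    hB.inter (hS.measurable_mode n hτ (measurableSet_singleton i))
  rw [← (h i).stopped_eq hT hτ hA]
  refine setIntegral_congr_fun (hτ.measurableSpace_le _ hA) fun ω hω => ?_
  have hi : S.ξ n ω = i := hω.2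
  have hs := hS.τ_succ_eq n ω
  rw [hi, contactTime] at hs
  simp only [gain, hs]

end IsFirstHitting

/-- The ties in the obstacle can be broken measurably. -/
theorem exists_select (hm : 2 ≤ m) :
    ∃ f : Fin m → Time T → Ω → Fin m, (∀ i s ω, f i s ω ≠ i ∧
      obstacle g X Y i s ω = -g i (f i s ω) s (X s ω) + Y (f i s ω) s ω) ∧
      ∀ (m' : MeasurableSpace Ω) (τ : Ω → Time T),
        (∀ i j, Measurable[m'] fun ω => g i j (τ ω) (X (τ ω) ω)) →
        (∀ j, Measurable[m'] fun ω => Y j (τ ω) ω) →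
        ∀ i, Measurable[m'] fun ω => f i (τ ω) ω := by
  set A : Fin m → Time T → Ω → Fin m → Prop := fun i s ω j =>
    j ≠ i ∧ obstacle g X Y i s ω = -g i j s (X s ω) + Y j s ω with hA
  -- Ties go to the least maximizing mode, which is determined by finitely many measurable
  -- comparisons.
  have hex : ∀ i s ω, ∃ j, A i s ω j ∧ ∀ j' < j, ¬A i s ω j' := fun i s ω => by
    have hne : {j | A i s ω j}.Nonempty := exists_eq_obstacle hm i s ω
    exact ⟨wellFounded_lt.min _ hne, wellFounded_lt.min_mem _ hne, fun j' hj' hA' =>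
      wellFounded_lt.not_lt_min _ (show j' ∈ {j | A i s ω j} from hA') hj'⟩
  choose f hf hfmin using hex
  refine ⟨f, hf, fun m' τ hg hY i => measurable_to_countable' fun j => ?_⟩
  have hAm : ∀ j, MeasurableSet[m'] {ω | A i (τ ω) ω j} := fun j =>
    (MeasurableSet.const _).inter (measurableSet_eq_fun
      (measurable_obstacle (hg i) hY) ((hg i j).neg.add (hY j)))
  have heq : (fun ω => f i (τ ω) ω) ⁻¹' {j} =
      {ω | A i (τ ω) ω j} ∩ ⋂ j' : Fin m, {ω | j' < j → ¬A i (τ ω) ω j'} := by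
    ext ω
    simp only [Set.mem_preimage, Set.mem_singleton_iff, Set.mem_inter_iff, Set.mem_iInter,
      Set.mem_ofPred_eq]
    constructor
    · rintro rfl
      exact ⟨hf _ _ _, hfmin _ _ _⟩
    · rintro ⟨h1, h2⟩
      rcases lt_trichotomy (f i (τ ω) ω) j with hlt | heq | hlt
      · exact absurd (hf _ _ _) (h2 _ hlt)
      · exact heq
      · exact absurd h1 (hfmin _ _ _ _ hlt)
  rw [heq]
  refine (hAm j).inter (MeasurableSet.iInter fun j' => ?_)
  by_cases hj : j' < j
  · simp only [hj, true_imp_iff]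
    exact (hAm j').compl
  · simp only [hj, false_imp_iff]
    exact MeasurableSet.const _

theorem exists_isFirstHitting (hm : 2 ≤ m)
    (hg : ∀ i j, IsStronglyProgressive F fun t ω => g i j t (X t ω))
    (hY : ∀ i, IsStronglyProgressive F (Y i))
    (h : ∀ i, IsSnellEnvelope F P (Y i) (obstacle g X Y i)
      (running fun t ω => ψ i t (X t ω)) W) (i₀ : Fin m) :
    ∃ S : Strategy T Ω m, IsFirstHitting g X Y F i₀ S := by
  obtain ⟨f, hf, hfm⟩ := exists_select (g := g) (X := X) (Y := Y) hm
  set p : ℕ → Ω → Time T × Fin m := fun n ω => Nat.rec (⊥, i₀) (fun _ q =>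
    (contactTime g X Y q.2 q.1 ω, f q.2 (contactTime g X Y q.2 q.1 ω) ω)) n with hp
  -- The two properties go through the induction together: the next time is a stopping time because
  -- the current mode is known, and the next mode is chosen at that stopping time.
  have hmeas : ∀ n, IsStopping F (fun ω => (p n ω).1) ∧
      ∀ hτ : IsStopping F (fun ω => (p n ω).1),
        Measurable[IsStoppingTime.measurableSpace hτ] fun ω => (p n ω).2 := fun n => by
    induction n with
    | zero => exact ⟨isStopping_const ⊥, fun hτ => @measurable_const _ _ _ (_) i₀⟩
    | succ n ih =>
      refine ⟨ih.1.select (ih.2 ih.1) (isStopping_contactTime h ih.1) fun i ω => le_firstHit _ _,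
        fun hτ => ?_⟩
      have hle := ih.1.mono_measurableSpace hτ fun ω => le_firstHit _ _
      exact measurable_select (hfm _ _ (fun i j => hτ.measurable_eval (hg i j))
        fun j => hτ.measurable_eval (hY j)) ((ih.2 ih.1).mono hle le_rfl)
  exact ⟨⟨fun n ω => (p n ω).1, fun n ω => (p n ω).2⟩, {
    τ_zero := fun ω => rfl
    ξ_zero := fun ω => rfl
    τ_succ := fun n ω => (sInf_contact_eq _ _ _).symm
    ξ_succ := fun n ω _ => hf _ _ _
    measurable_mode := fun n => (hmeas n).2 }⟩

end FirstHitting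

end OptimalSwitching

namespace OptimalSwitching

/-! ### Extended expectations, integrable costs and triviality at time zero. -/

section Value

open Filter Topology

set_option linter.unusedSectionVars false

variable {T : ℝ} [Fact (0 ≤ T)] {Ω : Type*} {mΩ : MeasurableSpace Ω} {k m : ℕ}
  {F : Filtration (Time T) mΩ} {P : Measure Ω}
  {ψ : Fin m → Time T → EuclideanSpace ℝ (Fin k) → ℝ}
  {g : Fin m → Fin m → Time T → EuclideanSpace ℝ (Fin k) → ℝ}
  {X : Time T → Ω → EuclideanSpace ℝ (Fin k)} {S : Strategy T Ω m} {i₀ : Fin m}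

theorem expectation_mono {f h : Ω → ℝ} (hfh : f ≤ᵐ[P] h) : expectation P f ≤ expectation P h := by
  refine EReal.sub_le_sub ?_ ?_
  · refine EReal.coe_ennreal_le_coe_ennreal_iff.2 (lintegral_mono_ae ?_)
    filter_upwards [hfh] with ω hω using ENNReal.ofReal_le_ofReal hω
  · refine EReal.coe_ennreal_le_coe_ennreal_iff.2 (lintegral_mono_ae ?_)
    filter_upwards [hfh] with ω hω using ENNReal.ofReal_le_ofReal (neg_le_neg hω)

theorem expectation_eq_integral {f : Ω → ℝ} (hf : Integrable f P) :
    expectation P f = ((∫ ω, f ω ∂P : ℝ) : EReal) := by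
  have hn : ∫⁻ ω, ENNReal.ofReal (-f ω) ∂P ≠ ∞ := hf.neg.lintegral_lt_top.ne
  rw [integral_eq_lintegral_pos_part_sub_lintegral_neg_part hf, EReal.coe_sub,
    EReal.coe_ennreal_toReal hf.lintegral_lt_top.ne, EReal.coe_ennreal_toReal hn]
  rfl

theorem lintegral_ofReal_lt_top {f h : Ω → ℝ} (hfh : f ≤ᵐ[P] h) (hh : Integrable h P) :
    ∫⁻ ω, ENNReal.ofReal (f ω) ∂P < ∞ := by
  refine (lintegral_mono_ae ?_).trans_lt hh.lintegral_lt_top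
  filter_upwards [hfh] with ω hω using ENNReal.ofReal_le_ofReal hω

/-- The profit is almost surely the limit of the measurable partial profits, which are eventually
constant. -/
theorem IsAdmissible.aemeasurable_profit (hS : IsAdmissible F P i₀ S)
    (hψ : ∀ i ω, Continuous fun t => ψ i t (X t ω))
    (hψm : ∀ i t, Measurable fun ω => ψ i t (X t ω))
    (hg : ∀ i j ω, Continuous fun t => g i j t (X t ω))
    (hgm : ∀ i j t, Measurable fun ω => g i j t (X t ω)) : AEMeasurable (S.profit ψ g X) P := by
  refine aemeasurable_of_tendsto_metrizable_ae' (f := S.partialProfit ψ g X) (fun n =>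
    (Strategy.measurable_partialProfit hψ hψm hg hgm (fun n => (hS.stopping n).measurable) hS.mono
      (fun n => (hS.measurable_mode n (hS.stopping n)).mono
        (hS.stopping n).measurableSpace_le le_rfl) n).aemeasurable) ?_
  filter_upwards [hS.ae_exists_top] with ω ⟨N, hN⟩
  refine tendsto_const_nhds.congr' ?_
  filter_upwards [eventually_ge_atTop N] with n hn
  exact Strategy.profit_eq_partialProfit hψ (hS.monotone ω) (hS.τ_zero ω)
    (top_unique (hN ▸ hS.monotone ω hn))

/-- The total switching cost is integrable as soon as the profit is. -/
theorem IsAdmissible.integrable_totalCost (hS : IsAdmissible F P i₀ S)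
    (hψ : ∀ i ω, Continuous fun t => ψ i t (X t ω))
    (hψm : ∀ i t, Measurable fun ω => ψ i t (X t ω))
    (hψi : ∀ i, Integrable (fun ω => ∫ s, |ψ i s (X s ω)| ∂leb T) P)
    (hprofit : Integrable (S.profit ψ g X) P) : Integrable (S.totalCost g X) P := by
  have hcost : ∀ ω, S.totalCost (fun _ _ _ _ => 0) X ω = 0 := fun ω => by
    simp [Strategy.totalCost]
  -- With zero costs the profit is the running part alone, so its measurability comes from the
  -- general lemma.
  have hrun : Integrable (S.profit ψ (fun _ _ _ _ => 0) X) P := by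
    refine (integrable_finsetSum Finset.univ fun i _ => hψi i).mono'
      (hS.aemeasurable_profit hψ hψm (fun _ _ _ => continuous_const)
        fun _ _ _ => measurable_const).aestronglyMeasurable (ae_of_all _ fun ω => ?_)
    rw [Strategy.profit, hcost, sub_zero]
    exact Strategy.abs_integral_mode_le hψ ω
  refine (hrun.sub hprofit).congr (ae_of_all _ fun ω => ?_)
  simp only [Pi.sub_apply, Strategy.profit, hcost]
  ring

theorem ae_eq_integral_of_measurable {m' : MeasurableSpace Ω} (hm' : m' ≤ mΩ)
    [IsProbabilityMeasure P]
    (htriv : ∀ A, MeasurableSet[m'] A → A =ᵐ[P] (∅ : Set Ω) ∨ A =ᵐ[P] (Set.univ : Set Ω))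
    {f : Ω → ℝ} (hf : Measurable[m'] f) (hfi : Integrable f P) :
    ∀ᵐ ω ∂P, f ω = ∫ ω, f ω ∂P := by
  have h := ae_eq_condExp_of_forall_setIntegral_eq (g := fun _ => ∫ ω, f ω ∂P) hm' hfi
    (fun s _ _ => (integrable_const _).integrableOn) (fun s hs _ => ?_)
    aestronglyMeasurable_const
  · rw [condExp_of_stronglyMeasurable hm' hf.stronglyMeasurable hfi] at h
    exact h.symm
  · rcases htriv s hs with h | h
    · rw [setIntegral_congr_set h, setIntegral_congr_set h]
      simp
    · rw [setIntegral_congr_set h, setIntegral_congr_set h]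
      simp

/-- The completed natural filtration is trivial at time `0`. -/
theorem completedFiltration_bot_trivial {d : ℕ} {B : Time T → Ω → Fin d → ℝ}
    (hB : ∀ t, Measurable (B t)) (h0 : ∀ᵐ ω ∂P, B ⊥ ω = 0) {A : Set Ω}
    (hA : MeasurableSet[completedFiltration B hB P ⊥] A) :
    A =ᵐ[P] (∅ : Set Ω) ∨ A =ᵐ[P] (Set.univ : Set Ω) := by
  -- Each generator is almost surely empty or full, since `B ⊥` is almost surely `0`; so the whole
  -- `σ`-algebra lies in the completion of the trivial one.
  have hle : completedFiltration B hB P ⊥ ≤ @eventuallyMeasurableSpace Ω ⊥ (ae P) _ := by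
    refine sup_le (iSup₂_le fun r hr => ?_) (MeasurableSpace.generateFrom_le fun s hs =>
      ⟨∅, @MeasurableSet.empty _ ⊥, ae_eq_empty.2 hs.2⟩)
    rw [le_bot_iff.1 hr]
    rintro _ ⟨s, -, rfl⟩
    by_cases hs : (0 : Fin d → ℝ) ∈ s
    · refine ⟨Set.univ, @MeasurableSet.univ _ ⊥, eventuallyEq_univ.2 ?_⟩
      filter_upwards [h0] with ω hω
      simpa only [Set.mem_preimage, hω] using hs
    · refine ⟨∅, @MeasurableSet.empty _ ⊥, eventuallyEq_empty.2 ?_⟩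
      filter_upwards [h0] with ω hω
      simpa only [Set.mem_preimage, hω] using hs
  obtain ⟨t, ht, hAt⟩ := hle A hA
  rcases MeasurableSpace.measurableSet_bot_iff.1 ht with rfl | rfl
  · exact Or.inl hAt
  · exact Or.inr hAt

end Value

end OptimalSwitching

/-! ### The verification theorem. -/

theorem mainTheorem1
    {T : ℝ} [Fact (0 ≤ T)] (hT : 0 < T)
    {Ω : Type*} [mΩ : MeasurableSpace Ω] (P : Measure Ω) [IsProbabilityMeasure P]
    {d k m : ℕ} [NeZero m] (hm : 2 ≤ m)
    (B : OptimalSwitching.Time T → Ω → Fin d → ℝ)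
    (hB : OptimalSwitching.IsStdBrownianMotion B P)
    (F : Filtration (OptimalSwitching.Time T) mΩ)
    (hF : F = OptimalSwitching.completedFiltration B hB.measurable P)
    (X : OptimalSwitching.Time T → Ω → EuclideanSpace ℝ (Fin k))
    (hX_prog : IsStronglyProgressive F X)
    (hX_cont : ∀ ω, Continuous fun t => X t ω)
    (ψ : Fin m → OptimalSwitching.Time T → EuclideanSpace ℝ (Fin k) → ℝ)
    (g : Fin m → Fin m → OptimalSwitching.Time T → EuclideanSpace ℝ (Fin k) → ℝ)
    (hψ_cont : ∀ i, Continuous (Function.uncurry (ψ i)))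
    (hg_cont : ∀ i j, Continuous (Function.uncurry (g i j)))
    (hψ_M2 : ∀ i, OptimalSwitching.MemM2 F P fun t ω => ψ i t (X t ω))
    (hg_S2 : ∀ i j, OptimalSwitching.MemS2 F P fun t ω => g i j t (X t ω))
    (hg_diag : ∀ i t x, g i i t x = 0)
    (hg_loop : ∀ (n : ℕ) (c : ℕ → Fin m), 2 ≤ n → Set.InjOn c (Set.Iio n) → c n = c 0 →
      ∀ t x, 0 < ∑ l ∈ Finset.range n, g (c l) (c (l + 1)) t x)
    (Y : Fin m → OptimalSwitching.Time T → Ω → ℝ)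
    (hY_S2 : ∀ i, OptimalSwitching.MemS2 F P (Y i))
    (hY : OptimalSwitching.IsSnellSystem ψ g X Y F P) :
    -- `J` is well defined on admissible strategies, with values in `[-∞, ∞)`
    (∀ S : OptimalSwitching.Strategy T Ω m, OptimalSwitching.IsAdmissible F P 0 S →
      AEMeasurable (S.profit ψ g X) P ∧ ∫⁻ ω, ENNReal.ofReal (S.profit ψ g X ω) ∂P < ∞) ∧
    -- `Y¹` at time `0` is the value of the problem
    (∀ᵐ ω ∂P, ((Y 0 ⊥ ω : ℝ) : EReal) =
      ⨆ S : {S : OptimalSwitching.Strategy T Ω m // OptimalSwitching.IsAdmissible F P 0 S},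
        OptimalSwitching.J ψ g X P S.1) ∧
    -- strategies of first hitting times exist, and each of them is admissible and optimal,
    -- with finite expected total switching cost
    (∃ S : OptimalSwitching.Strategy T Ω m, OptimalSwitching.IsFirstHitting g X Y F 0 S) ∧
    ∀ S : OptimalSwitching.Strategy T Ω m, OptimalSwitching.IsFirstHitting g X Y F 0 S →
      OptimalSwitching.IsAdmissible F P 0 S ∧
      (∀ S' : OptimalSwitching.Strategy T Ω m, OptimalSwitching.IsAdmissible F P 0 S' →
        OptimalSwitching.J ψ g X P S' ≤ OptimalSwitching.J ψ g X P S) ∧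
      Integrable (S.totalCost g X) P := by
  have hψc : ∀ i ω, Continuous fun t => ψ i t (X t ω) := fun i ω =>
    (hψ_cont i).comp (continuous_id.prodMk (hX_cont ω))
  have hψm : ∀ i t, Measurable fun ω => ψ i t (X t ω) := fun i t =>
    (((hψ_M2 i).1.stronglyAdapted t).mono (F.le t)).measurable
  have hgc : ∀ i j ω, Continuous fun t => g i j t (X t ω) := fun i j => (hg_S2 i j).2.1
  have hgm : ∀ i j t, Measurable fun ω => g i j t (X t ω) := fun i j t =>
    ((hg_S2 i j).measurable t).mono (F.le t) le_rfl
  have hYc : ∀ i ω, Continuous fun t => Y i t ω := fun i => (hY_S2 i).2.1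
  obtain ⟨W, hW⟩ :=
    OptimalSwitching.isSnellEnvelope_of_isSnellSystem hT hm hψc hψ_M2 hg_S2 hY_S2 hY
  have hle : ∀ S, OptimalSwitching.IsAdmissible F P 0 S →
      ∃ R : Ω → ℝ, Integrable R P ∧ ∫ ω, R ω ∂P = ∫ ω, Y 0 ⊥ ω ∂P ∧ S.profit ψ g X ≤ᵐ[P] R :=
    fun S hS => by
      obtain ⟨R, hR, hR0, hSR, -⟩ := hS.exists_profit_le hT (hW 0).memLp_bound hW hψc hg_diag
      exact ⟨R, hR, hR0, hSR⟩
  have hJle : ∀ S, OptimalSwitching.IsAdmissible F P 0 S →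
      OptimalSwitching.J ψ g X P S ≤ ((∫ ω, Y 0 ⊥ ω ∂P : ℝ) : EReal) := fun S hS => by
    obtain ⟨R, hR, hR0, hSR⟩ := hle S hS
    rw [← hR0, ← OptimalSwitching.expectation_eq_integral hR]
    exact OptimalSwitching.expectation_mono hSR
  have hadm : ∀ S, OptimalSwitching.IsFirstHitting g X Y F 0 S →
      OptimalSwitching.IsAdmissible F P 0 S := fun S hS =>
    hS.isAdmissible hm hgc hYc hg_loop hW
  have hopt : ∀ S, OptimalSwitching.IsFirstHitting g X Y F 0 S →
      Integrable (S.profit ψ g X) P ∧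
      OptimalSwitching.J ψ g X P S = ((∫ ω, Y 0 ⊥ ω ∂P : ℝ) : EReal) := fun S hS => by
    obtain ⟨R, hR, hR0, -, hSR⟩ :=
      (hadm S hS).exists_profit_le hT (hW 0).memLp_bound hW hψc hg_diag
    have heq := hSR (fun i n B hB => hS.setIntegral_gain_eq_zero hT hW _ i hB)
      fun n ω => hS.value_eq hm hgc hYc n ω
    have hi : Integrable (S.profit ψ g X) P := hR.congr heq.symm
    refine ⟨hi, ?_⟩
    rw [OptimalSwitching.J, OptimalSwitching.expectation_eq_integral hi, integral_congr_ae heq, hR0]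
  have hex := OptimalSwitching.exists_isFirstHitting hm (fun i j => (hg_S2 i j).1)
    (fun i => (hY_S2 i).1) hW 0
  refine ⟨fun S hS => ⟨hS.aemeasurable_profit hψc hψm hgc hgm, ?_⟩, ?_, hex, fun S hS =>
    ⟨hadm S hS, fun S' hS' => ?_, ?_⟩⟩
  · obtain ⟨R, hR, -, hSR⟩ := hle S hS
    exact OptimalSwitching.lintegral_ofReal_lt_top hSR hR
  -- The bounds on `J` involve the mean of `Y 0 ⊥`; triviality of `F ⊥` identifies it with the
  -- random variable itself.
  · have hconst := OptimalSwitching.ae_eq_integral_of_measurable (P := P) (F.le ⊥) (fun A hA => by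
      rw [hF] at hA
      exact OptimalSwitching.completedFiltration_bot_trivial hB.measurable hB.start_zero hA)
      ((hY_S2 0).measurable ⊥) ((hW 0).integrable_value (τ := fun _ => ⊥) measurable_const)
    filter_upwards [hconst] with ω hω
    rw [hω]
    obtain ⟨S, hS⟩ := hex
    refine le_antisymm ?_ (iSup_le fun S => hJle S.1 S.2)
    rw [← (hopt S hS).2]
    exact le_iSup (fun S : {S : OptimalSwitching.Strategy T Ω m //
      OptimalSwitching.IsAdmissible F P 0 S} => OptimalSwitching.J ψ g X P S.1) ⟨S, hadm S hS⟩
  · rw [(hopt S hS).2]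
    exact hJle S' hS'
  · exact (hadm S hS).integrable_totalCost hψc hψm
      (fun i => ((hψ_M2 i).memLp_integral_abs hT (hψc i)).integrable one_le_two)
      (hopt S hS).1
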